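/- **Theorem (Third order coupling condition).** *Setting.* Let $(A,b)$ be a real Runge–Kutta method with $s$ stages (the slow base scheme), abscissae $c=A\mathbb 1$ with $c_1\le\dots\le c_s\le 1$, and increments $\Delta c_i=c_{i+1}-c_i$ for $i<s$, $\Delta c_s=1-c_s$. Let $\gamma_{i,j}(\tau)=\sum_{k=0}^m\gamma^k_{i,j}\tau^k$ ($1\le i,j\le s$) be polynomials, $\Gamma^k=[\gamma_{i,j}^k]$ and $\overline\Gamma=\sum_k\frac1{k+1}\Gamma^k$, with $\gamma^k_{i,j}=0$ for $j\ge i+2$, $\gamma^k_{i,i+1}\Delta c_i=0$, $A=\mathbf E\,\overline\Gamma$ and $b^T=\mathbb 1^T\overline\Gamma$, where $\mathbf E_{i,j}=1$ for $i>j$ and $0$ otherwise. For $y'=f^{F}(t,y)+f^{S}(t,y)$, one step of size $H$ of the MRI-GARK method from $(t_n,y_n)$ is: $Y_1=y_n$; for $i=1,\dots,s$, $Y_{i+1}=v(H)$, where $v(0)=Y_i$ and $$v'(\theta)=\Delta c_i\,f^{F}\bigl(T_i+\Delta c_i\theta,v\bigr)+\sum_{j}\gamma_{i,j}(\theta/H)\,f^{S}(T_j,Y_j),\quad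 \theta\in[0,H],\quad T_j=t_n+c_jH;$$ and $y_{n+1}=Y_{s+1}$. A method has *order (at least) $p$* if for all smooth right-hand sides, in every dimension, and every exact solution $y$ starting at $(t_n,y_n)$, for all small $H>0$ a step with stages near $y_n$ exists and all such steps satisfy $\|y_{n+1}-y(t_n+H)\|\le C H^{p+1}$ (with $C$ independent of $H$). Given a fast Runge–Kutta method $(A^F,b^F)$, $c^F=A^F\mathbb 1$, solving each fast system by one step of it gives the multirate GARK tableau whose blocks, for slow indices $i,l$, are $$\mathbf A^{ff}_{i,l}=\begin{cases}\Delta c_l\,\mathbb 1\, (b^{F})^{T}&l<i\\ \Delta c_i A^F&l=i\\0&l>i\end{cases},\quad \mathbf b^f_i=\Delta c_i\,b^F,\quad \mathbf A^{sf}_{i,l}=\begin{cases}\Delta c_l\,(b^{F})^{T}&l<i\\0&l\ge i\end{cases},\quad \mathbf A^{fs}_{i}=\mathbb 1A_{i,:}+\sum_k\bigl(A^F(c^F)^{\times k}\bigr)\Gamma^k_{i,:},$$ with $\mathbf A^{ss}=A$, $\mathbf b^s=b$ and $(c^F)^{\times k}$ the componentwise power. Put $\mathbf c^f=\mathbf A^{ff}\mathbb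 1$. The MRI-GARK method is *internally consistent* if $\mathbf A^{sf}\mathbb 1=c$ and $\mathbf A^{ff}\mathbb 1=\mathbf A^{fs}\mathbb 1$ for every fast method with $\sum_l b^F_l=1$. Finally let $\zeta_k=1/\gamma([\mathfrak t_k])=\frac1{(k+1)(k+2)}$, where $\gamma(\cdot)$ is the density of a rooted tree and $\mathfrak t_k=[\tau,\dots,\tau]$ ($k$ leaves), and let $\mathfrak A=A+\sum_{k}\zeta_k\Gamma^k$. *Claim.* Let an MRI-GARK method be internally consistent. 1. It has order (at least) three if and only if its slow base scheme $(A,b)$ has order at least three and $$\Delta c^T\,\mathfrak A\,c=\tfrac16 .$$ 2. For every fast Runge–Kutta method of sufficiently high order (order at least $m+2$ suffices), of the two third order coupling conditions $\mathbf b^{sT}\mathbf A^{sf}\mathbf c^f=\frac16$ and $\mathbf b^{fT}\mathbf A^{fs}c=\frac16$: the first holds automatically if the slow base scheme has order at least three, and $\mathbf b^{fT}\mathbf A^{fs}c=\Delta c^T\,\mathfrak A\,c$, so that the second is equivalent to $\Delta c^T\,\mathfrak A\,c=\frac16$. -/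

import Mathlib

open Matrix

noncomputable section

/-- Rooted trees: `node [t₁, …, tₖ]` joins the subtrees `t₁, …, tₖ` by a new root. -/
inductive ButcherTree : Type
  | node : List ButcherTree → ButcherTree

namespace ButcherTree

/-- The number of vertices of a rooted tree. -/
def order : ButcherTree → ℕ
  | node ts => 1 + (ts.attach.map fun t => order t.1).sum
termination_by t => sizeOf t
decreasing_by
  have := List.sizeOf_lt_of_mem t.2
  simp only [node.sizeOf_spec]
  omega

/-- The density `γ(t)` of a rooted tree: `γ([t₁, …, tₖ]) = |[t₁, …, tₖ]| γ(t₁) ⋯ γ(tₖ)`. -/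
def density : ButcherTree → ℕ
  | node ts => order (node ts) * (ts.attach.map fun t => density t.1).prod
termination_by t => sizeOf t
decreasing_by
  have := List.sizeOf_lt_of_mem t.2
  simp only [node.sizeOf_spec]
  omega

/-- The tree `τ` with a single vertex. -/
def tau : ButcherTree := node []

/-- The bushy tree `𝔱ₖ = [τ, …, τ]` with `k` leaves joined by a root. -/
def bushy (k : ℕ) : ButcherTree := node (List.replicate k tau)

end ButcherTree

/-- The coefficients `ζₖ = 1 / γ([𝔱ₖ])`. -/
def zeta (k : ℕ) : ℝ :=
  1 / ((ButcherTree.node [ButcherTree.bushy k]).density : ℝ)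

/-- `y` solves `y' = f(t, y)` on `[t₀, t₀ + δ]`. -/
def IsExactSolution {d : ℕ} (f : ℝ → EuclideanSpace ℝ (Fin d) → EuclideanSpace ℝ (Fin d))
    (t₀ δ : ℝ) (y : ℝ → EuclideanSpace ℝ (Fin d)) : Prop :=
  ∀ t ∈ Set.Icc t₀ (t₀ + δ), HasDerivWithinAt y (f t (y t)) (Set.Icc t₀ (t₀ + δ)) t

/-- A smooth (`C^∞`) time-dependent vector field. -/
def IsSmoothField {d : ℕ}
    (f : ℝ → EuclideanSpace ℝ (Fin d) → EuclideanSpace ℝ (Fin d)) : Prop :=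
  ContDiff ℝ (⊤ : ℕ∞) (fun x : ℝ × EuclideanSpace ℝ (Fin d) => f x.1 x.2)

/-- The local error of one step of a one-step method, along the exact solution `y` on
`[t₀, t₀ + δ]`, is `O(H ^ (p + 1))`. Here `step H Y y₁` says that a step of size `H` from `y t₀` at
time `t₀` may be carried out with stage values `Y` and result `y₁`. For all small `H > 0` a step
with stages near `y t₀` exists, and every such step has error at most `C H ^ (p + 1)`. (The
restriction to stages near `y t₀` only discards spurious solutions of implicit stage equations.) -/
def LocalErrorOrder {d n : ℕ} (p : ℕ)
    (step : ℝ → (Fin n → EuclideanSpace ℝ (Fin d)) → EuclideanSpace ℝ (Fin d) → Prop)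
    (t₀ δ : ℝ) (y : ℝ → EuclideanSpace ℝ (Fin d)) : Prop :=
  ∃ H₀ ∈ Set.Ioc 0 δ, ∃ r > (0 : ℝ), ∃ C : ℝ, ∀ H ∈ Set.Ioc 0 H₀,
    (∃ Y y₁, (∀ i, Y i ∈ Metric.closedBall (y t₀) r) ∧ step H Y y₁) ∧
    ∀ Y y₁, (∀ i, Y i ∈ Metric.closedBall (y t₀) r) → step H Y y₁ →
      ‖y₁ - y (t₀ + H)‖ ≤ C * H ^ (p + 1)

/-- A Runge–Kutta method with `s` stages, matrix `A` and weights `b`. -/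
structure RKMethod (s : ℕ) where
  A : Matrix (Fin s) (Fin s) ℝ
  b : Fin s → ℝ

namespace RKMethod

variable {s : ℕ}

/-- The abscissae `c = A 𝟙`. -/
def c (R : RKMethod s) : Fin s → ℝ := R.A *ᵥ 1

/-- One Runge–Kutta step of size `H` for `y' = f(t, y)` from `(t₀, y₀)`, with stages `Y` and
result `y₁`. -/
def Step (R : RKMethod s) {d : ℕ}
    (f : ℝ → EuclideanSpace ℝ (Fin d) → EuclideanSpace ℝ (Fin d))
    (t₀ : ℝ) (y₀ : EuclideanSpace ℝ (Fin d)) (H : ℝ)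
    (Y : Fin s → EuclideanSpace ℝ (Fin d)) (y₁ : EuclideanSpace ℝ (Fin d)) : Prop :=
  (∀ i, Y i = y₀ + H • ∑ j, R.A i j • f (t₀ + R.c j * H) (Y j)) ∧
  y₁ = y₀ + H • ∑ j, R.b j • f (t₀ + R.c j * H) (Y j)

/-- The Runge–Kutta method has order at least `p`: for every smooth initial value problem, in every
dimension, its local error is `O(H ^ (p + 1))`. -/
def HasOrder (R : RKMethod s) (p : ℕ) : Prop :=
  ∀ (d : ℕ) (f : ℝ → EuclideanSpace ℝ (Fin d) → EuclideanSpace ℝ (Fin d)),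
    IsSmoothField f →
    ∀ (t₀ δ : ℝ) (y : ℝ → EuclideanSpace ℝ (Fin d)), 0 < δ → IsExactSolution f t₀ δ y →
      LocalErrorOrder p (R.Step f t₀ (y t₀)) t₀ δ y

/-- The increments `Δcᵢ = cᵢ₊₁ - cᵢ` between consecutive abscissae, with `1` following the last. -/
def deltaC (R : RKMethod s) (i : Fin s) : ℝ :=
  (if h : i.val + 1 < s then R.c ⟨i.val + 1, h⟩ else 1) - R.c i

end RKMethod

/-- The strictly lower triangular matrix `𝐄` of ones. -/
def lowerOnes (s : ℕ) : Matrix (Fin s) (Fin s) ℝ :=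
  Matrix.of fun i j => if j < i then 1 else 0

/-- An MRI-GARK method with `s` slow stages: a slow Runge–Kutta base method with nondecreasing
abscissae bounded by one, and slow tendency coefficients
`γᵢⱼ(τ) = ∑ₖ (Γ k) i j τᵏ`, polynomials of degree at most `m`. -/
structure MRIGARK (s m : ℕ) where
  base : RKMethod s
  Γ : Fin (m + 1) → Matrix (Fin s) (Fin s) ℝ
  abscissae_mono : Monotone base.c
  abscissae_le_one : ∀ i, base.c i ≤ 1
  /-- Stage `i + 1` is computed from the slow stages up to number `i + 1` only. -/
  gamma_eq_zero : ∀ k i j, i.val + 2 ≤ j.val → Γ k i j = 0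
  /-- A stage may be implicit only where the abscissa does not move. -/
  gamma_mul_deltaC : ∀ k i j, j.val = i.val + 1 → Γ k i j * base.deltaC i = 0
  /-- `A = 𝐄 Γ̄`, where `Γ̄ = ∑ₖ Γ k / (k + 1)` is the integral of `γ` over `[0, 1]`. -/
  base_A : base.A = lowerOnes s * ∑ k, (1 / ((k.val : ℝ) + 1)) • Γ k
  /-- `bᵀ = 𝟙ᵀ Γ̄`. -/
  base_b : base.b = 1 ᵥ* ∑ k, (1 / ((k.val : ℝ) + 1)) • Γ k

namespace MRIGARK

variable {s m : ℕ}

/-- The slow tendency coefficient `γᵢⱼ(τ) = ∑ₖ (Γ k) i j τᵏ`. -/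
def gamma (M : MRIGARK s m) (i j : Fin s) (τ : ℝ) : ℝ := ∑ k, M.Γ k i j * τ ^ k.val

/-- The matrix `𝔄 = A + ∑ₖ ζₖ Γᵏ`. -/
def frakA (M : MRIGARK s m) : Matrix (Fin s) (Fin s) ℝ :=
  M.base.A + ∑ k, zeta k.val • M.Γ k

/-- One step of size `H` of the MRI-GARK method for `y' = fF(t, y) + fS(t, y)` from `(t₀, y₀)`:
`Y₁ = y₀`, each `Yᵢ₊₁ = v(H)` for a solution `v` on `[0, H]` of the modified fast system
`v' = Δcᵢ fF(Tᵢ + Δcᵢ θ, v) + ∑ⱼ γᵢⱼ(θ/H) fS(Tⱼ, Yⱼ)`, `v(0) = Yᵢ`, `Tⱼ = t₀ + cⱼ H`,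
and the result is `y₁ = Yₛ₊₁`. -/
def Step (M : MRIGARK s m) {d : ℕ}
    (fF fS : ℝ → EuclideanSpace ℝ (Fin d) → EuclideanSpace ℝ (Fin d))
    (t₀ : ℝ) (y₀ : EuclideanSpace ℝ (Fin d)) (H : ℝ)
    (Y : Fin (s + 1) → EuclideanSpace ℝ (Fin d)) (y₁ : EuclideanSpace ℝ (Fin d)) : Prop :=
  Y 0 = y₀ ∧
  (∀ i : Fin s, ∃ v : ℝ → EuclideanSpace ℝ (Fin d),
    v 0 = Y i.castSucc ∧
    (∀ θ ∈ Set.Icc 0 H, HasDerivWithinAt v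
      (M.base.deltaC i • fF (t₀ + M.base.c i * H + M.base.deltaC i * θ) (v θ) +
        ∑ j, M.gamma i j (θ / H) • fS (t₀ + M.base.c j * H) (Y j.castSucc))
      (Set.Icc 0 H) θ) ∧
    Y i.succ = v H) ∧
  y₁ = Y (Fin.last s)

/-- The MRI-GARK method has order at least `p`: for every smooth additively partitioned initial
value problem, in every dimension, its local error is `O(H ^ (p + 1))`. -/
def HasOrder (M : MRIGARK s m) (p : ℕ) : Prop :=
  ∀ (d : ℕ) (fF fS : ℝ → EuclideanSpace ℝ (Fin d) → EuclideanSpace ℝ (Fin d)),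
    IsSmoothField fF → IsSmoothField fS →
    ∀ (t₀ δ : ℝ) (y : ℝ → EuclideanSpace ℝ (Fin d)), 0 < δ →
      IsExactSolution (fun t x => fF t x + fS t x) t₀ δ y →
      LocalErrorOrder p (M.Step fF fS t₀ (y t₀)) t₀ δ y

/-! The multirate GARK tableau obtained when every fast solve is done by one step of a fast
Runge–Kutta method `F` with `n` stages. The fast stages are indexed by pairs (sub-step, stage). -/

variable {n : ℕ}

/-- The fast-fast matrix: blocks `Δc_l 𝟙 bᵀ` below, and `Δcᵢ A` on, the diagonal. -/
def tabAff (M : MRIGARK s m) (F : RKMethod n) : Matrix (Fin s × Fin n) (Fin s × Fin n) ℝ :=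
  Matrix.of fun p q =>
    if q.1 < p.1 then M.base.deltaC q.1 * F.b q.2
    else if q.1 = p.1 then M.base.deltaC p.1 * F.A p.2 q.2
    else 0

/-- The fast weights `Δc ⊗ b`. -/
def tabbf (M : MRIGARK s m) (F : RKMethod n) : Fin s × Fin n → ℝ :=
  fun p => M.base.deltaC p.1 * F.b p.2

/-- The slow-fast matrix: block `l` is `Δc_l 𝐠_{l+1} bᵀ`, where `𝐠_{l+1}` has ones in the
positions after `l`. -/
def tabAsf (M : MRIGARK s m) (F : RKMethod n) : Matrix (Fin s) (Fin s × Fin n) ℝ :=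
  Matrix.of fun i q => if q.1 < i then M.base.deltaC q.1 * F.b q.2 else 0

/-- The fast-slow matrix: block `i` is `𝟙 Aᵢ + ∑ₖ (A cᵏ) (Γᵏ)ᵢ`, with componentwise powers of `c`
and `Aᵢ`, `(Γᵏ)ᵢ` the rows of the slow matrices. -/
def tabAfs (M : MRIGARK s m) (F : RKMethod n) : Matrix (Fin s × Fin n) (Fin s) ℝ :=
  Matrix.of fun p j =>
    M.base.A p.1 j + ∑ k : Fin (m + 1), (F.A *ᵥ fun l => F.c l ^ k.val) p.2 * M.Γ k p.1 j

/-- Internal consistency: the row sums satisfy `c^{s,f} = c^{s,s}` and `c^{f,f} = c^{f,s}`, for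
every (consistent) fast Runge–Kutta method. -/
def InternallyConsistent (M : MRIGARK s m) : Prop :=
  ∀ (n : ℕ) (F : RKMethod n), ∑ l, F.b l = 1 →
    M.tabAsf F *ᵥ 1 = M.base.c ∧ M.tabAff F *ᵥ 1 = M.tabAfs F *ᵥ 1

end MRIGARK

end

/-!
The proof compares the stages of a step with the exact solution `y` at the same times. In the
rescaled time `τ ∈ [0, 1]` of stage `i`, the error `e` of the stage has the derivative

`H (Δcᵢ (fF(v) - fF(y)) + ∑ⱼ γᵢⱼ(τ) (fS(Yⱼ) - φ(cⱼ H)) + (∑ⱼ γᵢⱼ(τ) φ(cⱼ H) - Δcᵢ φ))`,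

where `φ` is the slow field along `y`. Internal consistency amounts to `c₁ = 0`
(`InternallyConsistent.node_zero`) and `∑ⱼ γᵢⱼ(τ) = Δcᵢ` (`InternallyConsistent.sum_gamma`), so that
the last bracket, a quadrature defect, is `O(H)`, and the Taylor expansion
`φ₀ + h φ₁ + h² φ₂ + O(h³)` of `φ` describes it up to `O(H³)`. Integrating three times in
succession yields `e = O(H²)`, then `e = H² p(τ) φ₁ + O(H³)` with an explicit polynomial `p`, and
finally, once the slow base scheme satisfies its own third order conditions,

`y₁ - y(t₀ + H) = (Δcᵀ 𝔄 c - 1/6) H³ (∂fF/∂y) φ₁ + O(H⁴)`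

(`StepFamily.isBigO_error`, and `exists_local_error_expansion` for individual steps). The summand
`∑ₖ ζₖ Γᵏ` of `𝔄` is what two integrations of `γᵢⱼ` over `[0, 1]` leave. All `O`-terms have to be
uniform over the steps of a given size, of which there may be many since the stages may be implicit. They are
Landau symbols along the filter `unitTime ι` for a family of steps indexed by `ι`.

Sufficiency of the two conditions follows from the expansion together with the existence of steps
(`StepBound.exists_step`): a stage whose abscissa moves is an explicit initial value problem, which
the Picard–Lindelöf theorem solves, and any other stage is the fixed point of a contraction. For
necessity, with `fF = 0` the method is its slow base scheme (`HasOrder.base`), and the problem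
`y' = y + t` with slow part `t` makes the leading error term visible (`HasOrder.coupling`).

The order conditions of a Runge–Kutta method for the trees `𝔱ₖ` and `[𝔱ₖ]` are read off the problem
`y₁' = tᵏ`, `y₂' = y₁` (`RKMethod.HasOrder.sum_b_mul_c_pow`,
`RKMethod.HasOrder.sum_b_mul_A_mul_c_pow`). For a fast method of order `m + 2` they evaluate
the two coupling conditions of the tableau.
-/

noncomputable section

/-! ### Density of the bushy trees -/

namespace ButcherTree

theorem order_node (ts : List ButcherTree) : (node ts).order = 1 + (ts.map order).sum := by
  rw [order, ts.attach_map_val (f := order)]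

theorem density_node (ts : List ButcherTree) :
    (node ts).density = (node ts).order * (ts.map density).prod := by
  rw [density, ts.attach_map_val (f := density)]

theorem order_bushy (k : ℕ) : (bushy k).order = k + 1 := by
  simp [bushy, tau, order_node, add_comm]

theorem density_bushy (k : ℕ) : (bushy k).density = k + 1 := by
  have h := order_bushy k
  rw [bushy] at h ⊢
  rw [density_node, h]
  simp [tau, density_node, order_node]

end ButcherTree

theorem zeta_eq (k : ℕ) : zeta k = 1 / (((k : ℝ) + 1) * ((k : ℝ) + 2)) := by
  have h : (ButcherTree.node [ButcherTree.bushy k]).density = (k + 2) * (k + 1) := by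
    rw [ButcherTree.density_node, ButcherTree.order_node]
    simp [ButcherTree.order_bushy, ButcherTree.density_bushy]
    ring
  rw [zeta, h]
  push_cast
  ring

/-! ### Telescoping sums over stages -/

theorem Fin.sum_filter_castSucc_lt_succ {V : Type*} [AddCommMonoid V] {s : ℕ} (q : Fin s → V)
    (i : Fin s) : ∑ l : Fin s, (if l.castSucc < i.succ then q l else 0) =
      ∑ l : Fin s, (if l.castSucc < i.castSucc then q l else 0) + q i := by
  have h : ∀ l : Fin s, (if l.castSucc < i.succ then q l else 0) =
      (if l.castSucc < i.castSucc then q l else 0) + if l = i then q l else 0 := by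
    intro l
    rcases lt_trichotomy l i with hl | rfl | hl
    · simp [hl, hl.ne, Fin.castSucc_lt_succ_iff, hl.le]
    · simp
    · simp [hl.ne', Fin.castSucc_lt_succ_iff, hl.not_ge, hl.not_gt]
  rw [Finset.sum_congr rfl fun l _ => h l, Finset.sum_add_distrib]
  simp

theorem Fin.sum_filter_succ_sub_castSucc {V : Type*} [AddCommGroup V] {s : ℕ}
    (X : Fin (s + 1) → V) (i : Fin (s + 1)) :
    ∑ l : Fin s, (if l.castSucc < i then X l.succ - X l.castSucc else 0) = X i - X 0 := by
  induction i using Fin.induction with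
  | zero => simp
  | succ i ih =>
    rw [Fin.sum_filter_castSucc_lt_succ, ih]
    abel

theorem Fin.sum_succ_sub_castSucc {V : Type*} [AddCommGroup V] {s : ℕ} (X : Fin (s + 1) → V) :
    ∑ l : Fin s, (X l.succ - X l.castSucc) = X (Fin.last s) - X 0 := by
  simpa [Fin.castSucc_lt_last] using Fin.sum_filter_succ_sub_castSucc X (Fin.last s)

namespace RKMethod

variable {s : ℕ}

/-- The abscissae `c₁, …, c_s` followed by `1`. -/
def node (R : RKMethod s) : Fin (s + 1) → ℝ := Fin.snoc R.c 1

@[simp] theorem node_castSucc (R : RKMethod s) (i : Fin s) : R.node i.castSucc = R.c i := by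
  simp [node]

@[simp] theorem node_last (R : RKMethod s) : R.node (Fin.last s) = 1 := by
  simp [node]

theorem node_succ (R : RKMethod s) (i : Fin s) : R.node i.succ = R.c i + R.deltaC i := by
  unfold deltaC
  split_ifs with h
  · have : i.succ = (⟨i.val + 1, h⟩ : Fin s).castSucc := rfl
    rw [this, node_castSucc]
    ring
  · have : i.succ = Fin.last s := Fin.ext (by simp; omega)
    rw [this, node_last]
    ring

theorem deltaC_eq (R : RKMethod s) (i : Fin s) :
    R.deltaC i = R.node i.succ - R.node i.castSucc := by
  rw [node_succ, node_castSucc]; ring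

end RKMethod

/-! ### Slow tendency coefficients and the multirate tableau -/

namespace MRIGARK

variable {s m n : ℕ}

/-- The antiderivative `∫₀^τ γᵢⱼ` of the slow tendency coefficient. -/
def gammaInt (M : MRIGARK s m) (i j : Fin s) (τ : ℝ) : ℝ :=
  ∑ k, M.Γ k i j * (τ ^ (k.val + 1) / ((k.val : ℝ) + 1))

/-- The second antiderivative `∫₀^τ ∫₀^σ γᵢⱼ` of the slow tendency coefficient. -/
def gammaIntInt (M : MRIGARK s m) (i j : Fin s) (τ : ℝ) : ℝ :=
  ∑ k, M.Γ k i j * (τ ^ (k.val + 2) / (((k.val : ℝ) + 1) * ((k.val : ℝ) + 2)))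

theorem continuous_gamma (M : MRIGARK s m) (i j : Fin s) : Continuous (M.gamma i j) := by
  unfold gamma; fun_prop

theorem hasDerivAt_gammaInt (M : MRIGARK s m) (i j : Fin s) (τ : ℝ) :
    HasDerivAt (M.gammaInt i j) (M.gamma i j τ) τ := by
  unfold gammaInt gamma
  refine HasDerivAt.fun_sum fun k _ => ?_
  have h := ((hasDerivAt_pow (k.val + 1) τ).div_const ((k.val : ℝ) + 1)).const_mul (M.Γ k i j)
  refine h.congr_deriv ?_
  have : (k.val : ℝ) + 1 ≠ 0 := by positivity
  simp only [Nat.add_sub_cancel]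
  push_cast
  field_simp

theorem hasDerivAt_gammaIntInt (M : MRIGARK s m) (i j : Fin s) (τ : ℝ) :
    HasDerivAt (M.gammaIntInt i j) (M.gammaInt i j τ) τ := by
  unfold gammaInt gammaIntInt
  refine HasDerivAt.fun_sum fun k _ => ?_
  have h := ((hasDerivAt_pow (k.val + 2) τ).div_const
    (((k.val : ℝ) + 1) * ((k.val : ℝ) + 2))).const_mul (M.Γ k i j)
  refine h.congr_deriv ?_
  have h1 : (k.val : ℝ) + 1 ≠ 0 := by positivity
  have h2 : (k.val : ℝ) + 2 ≠ 0 := by positivity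
  have : k.val + 2 - 1 = k.val + 1 := by omega
  rw [this]
  push_cast
  field_simp

@[simp] theorem gammaInt_zero (M : MRIGARK s m) (i j : Fin s) : M.gammaInt i j 0 = 0 := by
  simp [gammaInt]

@[simp] theorem gammaIntInt_zero (M : MRIGARK s m) (i j : Fin s) : M.gammaIntInt i j 0 = 0 := by
  simp [gammaIntInt]

theorem base_A_apply (M : MRIGARK s m) (i j : Fin s) :
    M.base.A i j = ∑ l, if l < i then M.gammaInt l j 1 else 0 := by
  rw [M.base_A, Matrix.mul_apply]
  refine Finset.sum_congr rfl fun l _ => ?_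
  by_cases h : l < i
  · simp [lowerOnes, h, gammaInt, Matrix.sum_apply, mul_comm]
  · simp [lowerOnes, h]

theorem base_b_apply (M : MRIGARK s m) (j : Fin s) :
    M.base.b j = ∑ l, M.gammaInt l j 1 := by
  rw [M.base_b]
  simp [Matrix.vecMul, dotProduct, gammaInt, Matrix.sum_apply, mul_comm]

theorem frakA_apply (M : MRIGARK s m) (i j : Fin s) :
    M.frakA i j = M.base.A i j + M.gammaIntInt i j 1 := by
  simp [frakA, gammaIntInt, Matrix.sum_apply, zeta_eq, mul_comm]

theorem InternallyConsistent.sum_filter_deltaC {M : MRIGARK s m} (hM : M.InternallyConsistent)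
    (i : Fin s) : ∑ l, (if l < i then M.base.deltaC l else 0) = M.base.c i := by
  obtain ⟨h, -⟩ := hM 1 ⟨0, 1⟩ (by simp)
  have hi := congrFun h i
  simp only [tabAsf, Matrix.mulVec, dotProduct, Fintype.sum_prod_type, Matrix.of_apply] at hi
  simpa using hi

/-- Internal consistency forces the first abscissa to vanish. -/
theorem InternallyConsistent.node_zero {M : MRIGARK s m} (hM : M.InternallyConsistent)
    (i : Fin s) : M.base.node 0 = 0 := by
  have h1 := hM.sum_filter_deltaC i
  have h2 := Fin.sum_filter_succ_sub_castSucc M.base.node i.castSucc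
  simp only [Fin.castSucc_lt_castSucc_iff, RKMethod.node_castSucc] at h2
  simp only [M.base.deltaC_eq, RKMethod.node_castSucc] at h1
  linarith

/-- Internal consistency says that every row of slow tendency coefficients sums to the increment
of the abscissa. The fast methods with matrix `[[x, 0], [1, 0]]` read off the value at `x`. -/
theorem InternallyConsistent.sum_gamma {M : MRIGARK s m} (hM : M.InternallyConsistent)
    (i : Fin s) (τ : ℝ) : ∑ j, M.gamma i j τ = M.base.deltaC i := by
  obtain ⟨h1, h⟩ := hM 2 ⟨!![τ, 0; 1, 0], ![1, 0]⟩ (by simp)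
  have hi := congrFun h (i, 1)
  have hi1 := congrFun h1 i
  simp [tabAsf, tabAff, tabAfs, RKMethod.c, Matrix.mulVec, dotProduct, Fintype.sum_prod_type,
    Fin.sum_univ_two] at hi hi1
  have hs : ∀ l : Fin s, (if l < i then M.base.deltaC l else if l = i then M.base.deltaC i else 0)
      = (if l < i then M.base.deltaC l else 0) + if l = i then M.base.deltaC i else 0 := by
    intro l
    rcases lt_trichotomy l i with hl | rfl | hl
    · simp [hl, hl.ne]
    · simp
    · simp [hl.ne', hl.not_gt]
  rw [Finset.sum_congr rfl fun l _ => hs l, Finset.sum_add_distrib, Finset.sum_add_distrib,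
    hi1, add_right_inj] at hi
  simp only [gamma, mul_comm (M.Γ _ _ _), ← hi]
  simp

theorem InternallyConsistent.sum_filter_deltaC_mul {M : MRIGARK s m}
    (hM : M.InternallyConsistent) (i : Fin s) :
    ∑ l, (if l < i then M.base.deltaC l * (M.base.c l + M.base.deltaC l * (1 / 2)) else 0) =
      M.base.c i ^ 2 / 2 := by
  have h := Fin.sum_filter_succ_sub_castSucc (fun l => M.base.node l ^ 2 / 2) i.castSucc
  simp only [hM.node_zero i, RKMethod.node_castSucc, Fin.castSucc_lt_castSucc_iff,
    RKMethod.node_succ] at h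
  rw [show M.base.c i ^ 2 / 2 = M.base.c i ^ 2 / 2 - 0 ^ 2 / 2 by ring, ← h]
  refine Finset.sum_congr rfl fun l _ => ?_
  split_ifs
  · ring
  · rfl

/-- The abscissae of the fast stages: `cᵢ + Δcᵢ cᶠ` in block `i`. -/
theorem InternallyConsistent.tabAff_mulVec_one {M : MRIGARK s m} (hM : M.InternallyConsistent)
    (F : RKMethod n) (hb : ∑ a, F.b a = 1) (p : Fin s × Fin n) :
    (M.tabAff F *ᵥ 1) p = M.base.c p.1 + M.base.deltaC p.1 * F.c p.2 := by
  have hc : F.c p.2 = ∑ a, F.A p.2 a := by simp [RKMethod.c, Matrix.mulVec, dotProduct]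
  rw [← hM.sum_filter_deltaC p.1]
  simp only [tabAff, Matrix.mulVec, dotProduct, Matrix.of_apply, Pi.one_apply, mul_one,
    Fintype.sum_prod_type]
  have hl : ∀ l : Fin s, (∑ a, if l < p.1 then M.base.deltaC l * F.b a
      else if l = p.1 then M.base.deltaC p.1 * F.A p.2 a else 0) =
      (if l < p.1 then M.base.deltaC l else 0) +
        if l = p.1 then M.base.deltaC p.1 * F.c p.2 else 0 := by
    intro l
    rcases lt_trichotomy l p.1 with hl | hl | hl
    · simp [hl, hl.ne, ← Finset.mul_sum, hb]
    · simp [hl, ← Finset.mul_sum, hc]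
    · simp [hl.ne', hl.not_gt]
  rw [Finset.sum_congr rfl fun l _ => hl l, Finset.sum_add_distrib]
  simp

theorem InternallyConsistent.b_dotProduct_tabAsf {M : MRIGARK s m} (hM : M.InternallyConsistent)
    (F : RKMethod n) (hb : ∑ a, F.b a = 1) (hbc : ∑ a, F.b a * F.c a = 1 / 2) :
    M.base.b ⬝ᵥ (M.tabAsf F *ᵥ (M.tabAff F *ᵥ 1)) = (∑ j, M.base.b j * M.base.c j ^ 2) / 2 := by
  rw [Finset.sum_div]
  refine Finset.sum_congr rfl fun i _ => ?_
  rw [mul_div_assoc, ← hM.sum_filter_deltaC_mul i, ← hbc]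
  congr 1
  have hAsf : ∀ v : Fin s × Fin n → ℝ, (M.tabAsf F *ᵥ v) i =
      ∑ l, ∑ a, (if l < i then M.base.deltaC l * F.b a else 0) * v (l, a) := fun v => by
    simp only [Matrix.mulVec, dotProduct, Fintype.sum_prod_type, tabAsf, Matrix.of_apply]
  rw [hAsf]
  simp only [hM.tabAff_mulVec_one F hb]
  refine Finset.sum_congr rfl fun l _ => ?_
  split_ifs with h
  · calc ∑ a, M.base.deltaC l * F.b a * (M.base.c l + M.base.deltaC l * F.c a)
        = M.base.deltaC l * (M.base.c l * ∑ a, F.b a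
            + M.base.deltaC l * ∑ a, F.b a * F.c a) := by
          simp only [Finset.mul_sum, ← Finset.sum_add_distrib]
          exact Finset.sum_congr rfl fun a _ => by ring
      _ = _ := by rw [hb, mul_one]
  · simp

/-- The fast quadrature conditions `bᵀ A cᵏ = ζₖ` turn the fast stages of a block into the
second integral of the slow tendency coefficients. -/
theorem tabbf_dotProduct_tabAfs (M : MRIGARK s m) (F : RKMethod n) (hb : ∑ a, F.b a = 1)
    (hbA : ∀ k : Fin (m + 1), ∑ a, F.b a * (F.A *ᵥ fun l => F.c l ^ k.val) a = zeta k.val) :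
    M.tabbf F ⬝ᵥ (M.tabAfs F *ᵥ M.base.c) = M.base.deltaC ⬝ᵥ (M.frakA *ᵥ M.base.c) := by
  have hfs : ∀ i a, (M.tabAfs F *ᵥ M.base.c) (i, a) = ∑ j, (M.base.A i j + ∑ k : Fin (m + 1),
      (F.A *ᵥ fun l => F.c l ^ k.val) a * M.Γ k i j) * M.base.c j := fun i a => rfl
  have hfrak : ∀ i, (M.frakA *ᵥ M.base.c) i = ∑ j, (M.base.A i j + ∑ k : Fin (m + 1),
      zeta k.val * M.Γ k i j) * M.base.c j := fun i => by
    change ∑ j, M.frakA i j * M.base.c j = _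
    simp only [frakA, Matrix.add_apply, Matrix.sum_apply, Matrix.smul_apply, smul_eq_mul]
  simp only [dotProduct, Fintype.sum_prod_type, tabbf, hfs, hfrak, ← hbA]
  refine Finset.sum_congr rfl fun i _ => ?_
  simp only [mul_assoc, ← Finset.mul_sum]
  congr 1
  simp only [Finset.mul_sum]
  rw [Finset.sum_comm]
  refine Finset.sum_congr rfl fun j _ => ?_
  calc ∑ a, F.b a * ((M.base.A i j + ∑ k : Fin (m + 1),
          (F.A *ᵥ fun l => F.c l ^ k.val) a * M.Γ k i j) * M.base.c j)
      = (M.base.A i j * ∑ a, F.b a + ∑ a, ∑ k : Fin (m + 1),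
          F.b a * (F.A *ᵥ fun l => F.c l ^ k.val) a * M.Γ k i j) * M.base.c j := by
        simp only [Finset.mul_sum, ← Finset.sum_add_distrib, Finset.sum_mul]
        refine Finset.sum_congr rfl fun a _ => ?_
        simp only [mul_add, add_mul, Finset.mul_sum, Finset.sum_mul]
        congr 1
        · ring
        · exact Finset.sum_congr rfl fun k _ => by ring
    _ = _ := by
        rw [hb, mul_one, Finset.sum_comm]
        simp only [Finset.sum_mul]

end MRIGARK

/-! ### Order conditions of Runge–Kutta methods -/

theorem eq_zero_of_abs_mul_pow_le {a C H₀ : ℝ} {q : ℕ} (hH₀ : 0 < H₀)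
    (h : ∀ H ∈ Set.Ioc 0 H₀, |a| * H ^ q ≤ C * H ^ (q + 1)) : a = 0 := by
  by_contra hne
  have hpos : 0 < |a| := abs_pos.2 hne
  set H := min H₀ (|a| / (2 * (|C| + 1))) with hH
  have hH0 : 0 < H := lt_min hH₀ (by positivity)
  have hH3 : H * (2 * (|C| + 1)) ≤ |a| := (le_div_iff₀ (by positivity)).1 (min_le_right _ _)
  have h1 : |a| * H ^ q ≤ C * H * H ^ q := (h H ⟨hH0, min_le_left _ _⟩).trans_eq (by ring)
  have h2 : |a| ≤ C * H := le_of_mul_le_mul_right h1 (by positivity)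
  nlinarith [abs_nonneg C, mul_le_mul_of_nonneg_right (le_abs_self C) hH0.le]

/-- A problem on which every step has error at least `|a| H ^ q` limits the order of the method
to `q - 1`, unless `a = 0`. -/
theorem LocalErrorOrder.eq_zero {d n p q : ℕ}
    {step : ℝ → (Fin n → EuclideanSpace ℝ (Fin d)) → EuclideanSpace ℝ (Fin d) → Prop}
    {t₀ δ : ℝ} {y : ℝ → EuclideanSpace ℝ (Fin d)} (h : LocalErrorOrder p step t₀ δ y)
    (hqp : q ≤ p) {a : ℝ}
    (ha : ∀ H Y y₁, 0 < H → step H Y y₁ → |a| * H ^ q ≤ ‖y₁ - y (t₀ + H)‖) : a = 0 := by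
  obtain ⟨H₀, hH₀, r, hr, C, hC⟩ := h
  refine eq_zero_of_abs_mul_pow_le (q := q) (C := |C|) (lt_min hH₀.1 one_pos) fun H hH => ?_
  obtain ⟨⟨Y, y₁, hY, hs⟩, hall⟩ := hC H ⟨hH.1, hH.2.trans (min_le_left _ _)⟩
  refine ((ha H Y y₁ hH.1 hs).trans (hall Y y₁ hY hs)).trans ?_
  exact mul_le_mul (le_abs_self C)
    (pow_le_pow_of_le_one hH.1.le (hH.2.trans (min_le_right _ _)) (by omega))
    (pow_nonneg hH.1.le _) (abs_nonneg C)

/-- The problem `y₁' = tᵏ`, `y₂' = y₁`, whose exact solution from the origin is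
`y₁ = t ^ (k + 1) / (k + 1)`, `y₂ = t ^ (k + 2) / ((k + 1) (k + 2))`. -/
def monomialField (k : ℕ) (t : ℝ) (x : EuclideanSpace ℝ (Fin 2)) : EuclideanSpace ℝ (Fin 2) :=
  t ^ k • EuclideanSpace.single 0 1 + x 0 • EuclideanSpace.single 1 1

/-- The exact solution of `monomialField k` that starts at the origin. -/
def monomialSolution (k : ℕ) (t : ℝ) : EuclideanSpace ℝ (Fin 2) :=
  (t ^ (k + 1) / ((k : ℝ) + 1)) • EuclideanSpace.single 0 1 +
    (t ^ (k + 2) / (((k : ℝ) + 1) * ((k : ℝ) + 2))) • EuclideanSpace.single 1 1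

theorem isSmoothField_monomialField (k : ℕ) : IsSmoothField (monomialField k) := by
  unfold IsSmoothField monomialField
  fun_prop

theorem isExactSolution_monomialSolution (k : ℕ) :
    IsExactSolution (monomialField k) 0 1 (monomialSolution k) := by
  intro t _
  refine HasDerivAt.hasDerivWithinAt ?_
  have h1 : (k : ℝ) + 1 ≠ 0 := by positivity
  have h2 : (k : ℝ) + 2 ≠ 0 := by positivity
  have hd1 : HasDerivAt (fun t : ℝ => t ^ (k + 1) / ((k : ℝ) + 1)) (t ^ k) t := by
    refine ((hasDerivAt_pow (k + 1) t).div_const _).congr_deriv ?_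
    simp only [Nat.add_sub_cancel]; push_cast; field_simp
  have hd2 : HasDerivAt (fun t : ℝ => t ^ (k + 2) / (((k : ℝ) + 1) * ((k : ℝ) + 2)))
      (t ^ (k + 1) / ((k : ℝ) + 1)) t := by
    refine ((hasDerivAt_pow (k + 2) t).div_const _).congr_deriv ?_
    rw [show k + 2 - 1 = k + 1 by omega]; push_cast; field_simp
  refine ((hd1.smul_const (EuclideanSpace.single (0 : Fin 2) (1 : ℝ))).add
    (hd2.smul_const (EuclideanSpace.single (1 : Fin 2) (1 : ℝ)))).congr_deriv ?_
  simp [monomialField, monomialSolution]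

namespace RKMethod

variable {s p : ℕ}

theorem step_monomialField {R : RKMethod s} {k : ℕ} {H : ℝ}
    {Y : Fin s → EuclideanSpace ℝ (Fin 2)} {y₁ : EuclideanSpace ℝ (Fin 2)}
    (h : R.Step (monomialField k) 0 (monomialSolution k 0) H Y y₁) :
    y₁ 0 = H ^ (k + 1) * ∑ j, R.b j * R.c j ^ k ∧
      y₁ 1 = H ^ (k + 2) * ∑ j, R.b j * (R.A *ᵥ fun l => R.c l ^ k) j := by
  obtain ⟨hY, hy⟩ := h
  have hY0 : ∀ i, Y i 0 = H ^ (k + 1) * (R.A *ᵥ fun l => R.c l ^ k) i := by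
    intro i
    rw [hY i]
    simp [monomialField, monomialSolution, Matrix.mulVec, dotProduct, Finset.mul_sum]
    refine Finset.sum_congr rfl fun j _ => ?_
    ring
  rw [hy]
  constructor
  · simp [monomialField, monomialSolution, Finset.mul_sum]
    refine Finset.sum_congr rfl fun j _ => ?_
    ring
  · simp [monomialField, monomialSolution, hY0, Finset.mul_sum]
    refine Finset.sum_congr rfl fun j _ => ?_
    ring

/-- The order condition of the bushy tree with `k` leaves. -/
theorem HasOrder.sum_b_mul_c_pow {R : RKMethod s} (h : R.HasOrder p) {k : ℕ} (hk : k + 1 ≤ p) :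
    ∑ j, R.b j * R.c j ^ k = 1 / ((k : ℝ) + 1) := by
  have hl := h 2 _ (isSmoothField_monomialField k) 0 1 _ one_pos
    (isExactSolution_monomialSolution k)
  refine sub_eq_zero.1 (hl.eq_zero hk fun H Y y₁ hH hs => ?_)
  refine le_trans (le_of_eq ?_) (PiLp.norm_apply_le (y₁ - monomialSolution k (0 + H)) 0)
  rw [PiLp.sub_apply, (step_monomialField hs).1]
  simp only [monomialSolution, Real.norm_eq_abs]
  have habs := abs_mul (∑ j, R.b j * R.c j ^ k - 1 / ((k : ℝ) + 1)) (H ^ (k + 1))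
  rw [abs_of_pos (pow_pos hH (k + 1))] at habs
  rw [← habs]
  congr 1
  simp
  ring

/-- The order condition of the tree that joins the bushy tree with `k` leaves to a new root. -/
theorem HasOrder.sum_b_mul_A_mul_c_pow {R : RKMethod s} (h : R.HasOrder p) {k : ℕ}
    (hk : k + 2 ≤ p) : ∑ j, R.b j * (R.A *ᵥ fun l => R.c l ^ k) j = zeta k := by
  have hl := h 2 _ (isSmoothField_monomialField k) 0 1 _ one_pos
    (isExactSolution_monomialSolution k)
  rw [zeta_eq]
  refine sub_eq_zero.1 (hl.eq_zero hk fun H Y y₁ hH hs => ?_)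
  refine le_trans (le_of_eq ?_) (PiLp.norm_apply_le (y₁ - monomialSolution k (0 + H)) 1)
  rw [PiLp.sub_apply, (step_monomialField hs).2]
  simp only [monomialSolution, Real.norm_eq_abs]
  have habs := abs_mul (∑ j, R.b j * (R.A *ᵥ fun l => R.c l ^ k) j -
    1 / (((k : ℝ) + 1) * ((k : ℝ) + 2))) (H ^ (k + 2))
  rw [abs_of_pos (pow_pos hH (k + 2))] at habs
  rw [← habs]
  congr 1
  simp
  field_simp

end RKMethod

/-! ### Smooth fields and exact solutions -/

/-- On a compact cylinder around `(t₀, x₀)` the field `f` is bounded by `K` and Lipschitz in `x`, and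
increments in `x` are given by `A`, up to an error that is small near `(t₀, x₀)`. -/
structure FieldBound {d : ℕ} (f : ℝ → EuclideanSpace ℝ (Fin d) → EuclideanSpace ℝ (Fin d))
    (t₀ δ : ℝ) (x₀ : EuclideanSpace ℝ (Fin d)) (ρ K : ℝ)
    (A : EuclideanSpace ℝ (Fin d) →L[ℝ] EuclideanSpace ℝ (Fin d)) : Prop where
  nonneg : 0 ≤ K
  norm_le : ∀ t ∈ Set.Icc t₀ (t₀ + δ), ∀ x ∈ Metric.closedBall x₀ ρ, ‖f t x‖ ≤ K
  lipschitz : ∀ t ∈ Set.Icc t₀ (t₀ + δ), ∀ x ∈ Metric.closedBall x₀ ρ,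
    ∀ z ∈ Metric.closedBall x₀ ρ, ‖f t x - f t z‖ ≤ K * ‖x - z‖
  linear : ∀ t ∈ Set.Icc t₀ (t₀ + δ), ∀ x ∈ Metric.closedBall x₀ ρ,
    ∀ z ∈ Metric.closedBall x₀ ρ, ‖f t x - f t z - A (x - z)‖ ≤
      K * ((t - t₀) + ‖x - x₀‖ + ‖z - x₀‖) * ‖x - z‖

namespace IsSmoothField

variable {d : ℕ} {f : ℝ → EuclideanSpace ℝ (Fin d) → EuclideanSpace ℝ (Fin d)}

theorem continuous (hf : IsSmoothField f) :
    Continuous fun x : ℝ × EuclideanSpace ℝ (Fin d) => f x.1 x.2 :=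
  ContDiff.continuous hf

theorem differentiable (hf : IsSmoothField f) (t : ℝ) : Differentiable ℝ (f t) := by
  have h : ContDiff ℝ (⊤ : ℕ∞)
      ((fun x : ℝ × EuclideanSpace ℝ (Fin d) => f x.1 x.2) ∘ fun x => (t, x)) :=
    ContDiff.comp hf (contDiff_const.prodMk contDiff_id)
  exact h.differentiable (by simp)

/-- The derivative in `x` is again smooth, hence Lipschitz on compact convex sets. -/
theorem contDiff_fderiv (hf : IsSmoothField f) :
    ContDiff ℝ 1 fun x : ℝ × EuclideanSpace ℝ (Fin d) => fderiv ℝ (f x.1) x.2 := by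
  have h : ContDiff ℝ (⊤ : ℕ∞) (Function.uncurry fun x : ℝ × EuclideanSpace ℝ (Fin d) => f x.1) :=
    ContDiff.comp (g := fun x : ℝ × EuclideanSpace ℝ (Fin d) => f x.1 x.2)
      (f := fun z : (ℝ × EuclideanSpace ℝ (Fin d)) × EuclideanSpace ℝ (Fin d) => (z.1.1, z.2)) hf
      (by fun_prop)
  exact ContDiff.fderiv h contDiff_snd (by norm_cast)

theorem exists_fieldBound (hf : IsSmoothField f) (t₀ δ : ℝ) (hδ : 0 ≤ δ)
    (x₀ : EuclideanSpace ℝ (Fin d)) (ρ : ℝ) (hρ : 0 ≤ ρ) :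
    ∃ K, FieldBound f t₀ δ x₀ ρ K (fderiv ℝ (f t₀) x₀) := by
  set S : Set (ℝ × EuclideanSpace ℝ (Fin d)) :=
    Set.Icc t₀ (t₀ + δ) ×ˢ Metric.closedBall x₀ ρ with hS
  have hSc : IsCompact S := isCompact_Icc.prod (isCompact_closedBall _ _)
  have hSconv : Convex ℝ S := (convex_Icc _ _).prod (convex_closedBall _ _)
  have hC1 := hf.contDiff_fderiv
  obtain ⟨K₀, hK₀⟩ := hSc.exists_bound_of_continuousOn hf.continuous.continuousOn
  obtain ⟨K₁, hK₁⟩ := hSc.exists_bound_of_continuousOn hC1.continuous.continuousOn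
  obtain ⟨K₂, hK₂⟩ := hSc.exists_bound_of_continuousOn
    (hC1.continuous_fderiv one_ne_zero).continuousOn
  have ht₀ : t₀ ∈ Set.Icc t₀ (t₀ + δ) := ⟨le_rfl, by linarith⟩
  have hx₀ : x₀ ∈ Metric.closedBall x₀ ρ := Metric.mem_closedBall_self hρ
  have h00 : (t₀, x₀) ∈ S := ⟨ht₀, hx₀⟩
  have hn : 0 ≤ K₀ ∧ 0 ≤ K₁ ∧ 0 ≤ K₂ := ⟨(norm_nonneg _).trans (hK₀ _ h00),
    (norm_nonneg _).trans (hK₁ _ h00), (norm_nonneg _).trans (hK₂ _ h00)⟩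
  obtain ⟨hn0, hn1, hn2⟩ := hn
  have hlip : ∀ t ∈ Set.Icc t₀ (t₀ + δ), ∀ x ∈ Metric.closedBall x₀ ρ,
      ‖fderiv ℝ (f t) x - fderiv ℝ (f t₀) x₀‖ ≤ K₂ * ((t - t₀) + ‖x - x₀‖) := by
    intro t ht x hx
    have h := hSconv.norm_image_sub_le_of_norm_fderiv_le (𝕜 := ℝ)
      (f := fun x : ℝ × EuclideanSpace ℝ (Fin d) => fderiv ℝ (f x.1) x.2)
      (fun z _ => hC1.differentiable one_ne_zero z) hK₂ h00 (show (t, x) ∈ S from ⟨ht, hx⟩)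
    refine h.trans (mul_le_mul_of_nonneg_left ?_ hn2)
    rw [Prod.mk_sub_mk, Prod.norm_mk, Real.norm_of_nonneg (sub_nonneg.2 ht.1)]
    exact max_le (by linarith [norm_nonneg (x - x₀)]) (by linarith [ht.1])
  refine ⟨K₀ + K₁ + K₂, by positivity, fun t ht x hx => ?_, fun t ht x hx z hz => ?_,
    fun t ht x hx z hz => ?_⟩
  · exact (hK₀ (t, x) ⟨ht, hx⟩).trans (by linarith)
  · refine ((convex_closedBall x₀ ρ).norm_image_sub_le_of_norm_fderiv_le (𝕜 := ℝ)
      (fun w _ => hf.differentiable t w) (fun w hw => hK₁ (t, w) ⟨ht, hw⟩) hz hx).trans ?_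
    exact mul_le_mul_of_nonneg_right (by linarith) (norm_nonneg _)
  · -- the segment from `z` to `x` stays in the smaller ball on which the derivative is close to `A`
    set σ := max ‖x - x₀‖ ‖z - x₀‖ with hσ
    have hσρ : σ ≤ ρ := max_le (by simpa [dist_eq_norm] using hx) (by simpa [dist_eq_norm] using hz)
    have hσs : σ ≤ ‖x - x₀‖ + ‖z - x₀‖ :=
      max_le (by linarith [norm_nonneg (z - x₀)]) (by linarith [norm_nonneg (x - x₀)])
    have hxs : x ∈ Metric.closedBall x₀ σ := by simp [dist_eq_norm, hσ]
    have hzs : z ∈ Metric.closedBall x₀ σ := by simp [dist_eq_norm, hσ]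
    have h := (convex_closedBall x₀ σ).norm_image_sub_le_of_norm_fderiv_le' (𝕜 := ℝ)
      (f := f t) (φ := fderiv ℝ (f t₀) x₀) (C := (K₀ + K₁ + K₂) * ((t - t₀) + ‖x - x₀‖ + ‖z - x₀‖))
      (fun w _ => hf.differentiable t w) (fun w hw => ?_) hzs hxs
    · exact h
    · have hw' : ‖w - x₀‖ ≤ σ := by simpa [dist_eq_norm] using hw
      have htt : 0 ≤ t - t₀ := sub_nonneg.2 ht.1
      refine (hlip t ht w (Metric.closedBall_subset_closedBall hσρ hw)).trans ?_
      exact mul_le_mul (by linarith) (by linarith) (by positivity) (by positivity)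

theorem add {g : ℝ → EuclideanSpace ℝ (Fin d) → EuclideanSpace ℝ (Fin d)}
    (hf : IsSmoothField f) (hg : IsSmoothField g) : IsSmoothField fun t x => f t x + g t x :=
  ContDiff.add hf hg

theorem contDiffOn_comp (hf : IsSmoothField f) {n : ℕ} {y : ℝ → EuclideanSpace ℝ (Fin d)}
    {S : Set ℝ} (hy : ContDiffOn ℝ n y S) : ContDiffOn ℝ n (fun t => f t (y t)) S :=
  (ContDiff.of_le hf (by exact_mod_cast le_top)).comp_contDiffOn (contDiffOn_id.prodMk hy)

end IsSmoothField

/-- Exact solutions are smooth up to the ends of the interval. -/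
theorem IsExactSolution.contDiffOn {d : ℕ}
    {g : ℝ → EuclideanSpace ℝ (Fin d) → EuclideanSpace ℝ (Fin d)} (hg : IsSmoothField g)
    {t₀ δ : ℝ} {y : ℝ → EuclideanSpace ℝ (Fin d)} (hδ : 0 < δ) (hy : IsExactSolution g t₀ δ y)
    (n : ℕ) : ContDiffOn ℝ n y (Set.Icc t₀ (t₀ + δ)) := by
  have hu : UniqueDiffOn ℝ (Set.Icc t₀ (t₀ + δ)) := uniqueDiffOn_Icc (by linarith)
  induction n with
  | zero =>
    simp only [Nat.cast_zero, contDiffOn_zero]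
    exact fun t ht => (hy t ht).continuousWithinAt
  | succ n ih =>
    push_cast
    rw [contDiffOn_succ_iff_derivWithin hu]
    refine ⟨fun t ht => (hy t ht).differentiableWithinAt, by simp, ?_⟩
    exact (hg.contDiffOn_comp ih).congr fun t ht => (hy t ht).derivWithin (hu t ht)

theorem ContDiffOn.exists_norm_sub_quadratic_le {E : Type*} [NormedAddCommGroup E]
    [NormedSpace ℝ E] {φ : ℝ → E} {t₀ δ : ℝ} (hδ : 0 < δ)
    (hφ : ContDiffOn ℝ 3 φ (Set.Icc t₀ (t₀ + δ))) :
    ∃ (a b : E) (K : ℝ), ∀ h ∈ Set.Icc 0 δ,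
      ‖φ (t₀ + h) - φ t₀ - h • a - h ^ 2 • b‖ ≤ K * h ^ 3 := by
  obtain ⟨C, hC⟩ := exists_taylor_mean_remainder_bound (n := 2) (by linarith : t₀ ≤ t₀ + δ)
    (by exact_mod_cast hφ)
  refine ⟨iteratedDerivWithin 1 φ (Set.Icc t₀ (t₀ + δ)) t₀,
    (2⁻¹ : ℝ) • iteratedDerivWithin 2 φ (Set.Icc t₀ (t₀ + δ)) t₀, C, fun h hh => ?_⟩
  have := hC (t₀ + h) ⟨by linarith [hh.1], by linarith [hh.2]⟩
  simp only [add_sub_cancel_left, taylorWithinEval_succ, taylor_within_zero_eval] at this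
  refine le_trans (le_of_eq ?_) this
  congr 1
  norm_num
  module

/-! ### Stages in rescaled time and the slow base scheme -/

namespace MRIGARK

variable {s m d : ℕ}

/-- The right-hand side of the fast system of stage `i`, as a function of the rescaled time
`τ = θ / H ∈ [0, 1]`. -/
def stageField (M : MRIGARK s m) (fF fS : ℝ → EuclideanSpace ℝ (Fin d) → EuclideanSpace ℝ (Fin d))
    (t₀ H : ℝ) (Y : Fin (s + 1) → EuclideanSpace ℝ (Fin d)) (i : Fin s) (τ : ℝ)
    (x : EuclideanSpace ℝ (Fin d)) : EuclideanSpace ℝ (Fin d) :=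
  H • (M.base.deltaC i • fF (t₀ + H * (M.base.c i + M.base.deltaC i * τ)) x +
    ∑ j, M.gamma i j τ • fS (t₀ + H * M.base.c j) (Y j.castSucc))

/-- `v` solves the fast system of stage `i` in rescaled time, and joins `Yᵢ` to `Yᵢ₊₁`. -/
structure IsStage (M : MRIGARK s m)
    (fF fS : ℝ → EuclideanSpace ℝ (Fin d) → EuclideanSpace ℝ (Fin d))
    (t₀ H : ℝ) (Y : Fin (s + 1) → EuclideanSpace ℝ (Fin d)) (i : Fin s)
    (v : ℝ → EuclideanSpace ℝ (Fin d)) : Prop where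
  init : v 0 = Y i.castSucc
  deriv : ∀ τ ∈ Set.Icc (0 : ℝ) 1,
    HasDerivWithinAt v (M.stageField fF fS t₀ H Y i τ (v τ)) (Set.Icc 0 1) τ
  final : Y i.succ = v 1

theorem step_iff_isStage (M : MRIGARK s m)
    (fF fS : ℝ → EuclideanSpace ℝ (Fin d) → EuclideanSpace ℝ (Fin d)) (t₀ : ℝ)
    (y₀ : EuclideanSpace ℝ (Fin d)) {H : ℝ} (hH : 0 < H)
    (Y : Fin (s + 1) → EuclideanSpace ℝ (Fin d)) (y₁ : EuclideanSpace ℝ (Fin d)) :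
    M.Step fF fS t₀ y₀ H Y y₁ ↔
      Y 0 = y₀ ∧ (∀ i, ∃ v, M.IsStage fF fS t₀ H Y i v) ∧ y₁ = Y (Fin.last s) := by
  unfold Step
  refine and_congr_right fun _ => and_congr_left fun _ => forall_congr' fun i => ⟨?_, ?_⟩
  · rintro ⟨v, h0, hd, h1⟩
    refine ⟨fun τ => v (H * τ), by simpa using h0, fun τ hτ => ?_, by simpa using h1⟩
    have hm : Set.MapsTo (fun τ : ℝ => H * τ) (Set.Icc 0 1) (Set.Icc 0 H) := fun σ hσ =>
      ⟨mul_nonneg hH.le hσ.1, by nlinarith [hσ.2]⟩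
    have hl : HasDerivWithinAt (fun τ : ℝ => H * τ) H (Set.Icc 0 1) τ := by
      simpa using (hasDerivWithinAt_id τ (Set.Icc 0 1)).const_mul H
    refine ((hd (H * τ) (hm hτ)).scomp τ hl hm).congr_deriv ?_
    simp only [stageField, mul_div_cancel_left₀ τ hH.ne', mul_comm H (M.base.c _)]
    congr 4
    ring
  · rintro ⟨v, h0, hd, h1⟩
    refine ⟨fun θ => v (θ / H), by simpa using h0, fun θ hθ => ?_, by simpa [hH.ne'] using h1⟩
    have hm : Set.MapsTo (fun θ : ℝ => θ / H) (Set.Icc 0 H) (Set.Icc 0 1) := fun σ hσ =>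
      ⟨div_nonneg hσ.1 hH.le, (div_le_one hH).2 hσ.2⟩
    have hl : HasDerivWithinAt (fun θ : ℝ => θ / H) H⁻¹ (Set.Icc 0 H) θ := by
      simpa using (hasDerivWithinAt_id θ (Set.Icc 0 H)).div_const H
    refine ((hd (θ / H) (hm hθ)).scomp θ hl hm).congr_deriv ?_
    rw [stageField, smul_smul, inv_mul_cancel₀ hH.ne', one_smul]
    simp only [mul_comm H (M.base.c _)]
    congr 3
    field_simp
    ring

/-- Where the fast field is inactive, a stage is a quadrature. -/
theorem exists_isStage_iff (M : MRIGARK s m)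
    (fF fS : ℝ → EuclideanSpace ℝ (Fin d) → EuclideanSpace ℝ (Fin d)) (t₀ H : ℝ)
    (Y : Fin (s + 1) → EuclideanSpace ℝ (Fin d)) (i : Fin s)
    (h0 : ∀ t x, M.base.deltaC i • fF t x = 0) :
    (∃ v, M.IsStage fF fS t₀ H Y i v) ↔ Y i.succ = Y i.castSucc +
      H • ∑ j, M.gammaInt i j 1 • fS (t₀ + H * M.base.c j) (Y j.castSucc) := by
  set w : ℝ → EuclideanSpace ℝ (Fin d) := fun τ => Y i.castSucc +
      H • ∑ j, M.gammaInt i j τ • fS (t₀ + H * M.base.c j) (Y j.castSucc) with hw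
  have hwd : ∀ (τ : ℝ) (x : EuclideanSpace ℝ (Fin d)),
      HasDerivAt w (M.stageField fF fS t₀ H Y i τ x) τ := by
    intro τ x
    have h : HasDerivAt (fun τ => ∑ j, M.gammaInt i j τ • fS (t₀ + H * M.base.c j) (Y j.castSucc))
        (∑ j, M.gamma i j τ • fS (t₀ + H * M.base.c j) (Y j.castSucc)) τ :=
      HasDerivAt.fun_sum fun j _ => (M.hasDerivAt_gammaInt i j τ).smul_const _
    refine ((h.const_smul H).const_add (Y i.castSucc)).congr_deriv ?_
    rw [stageField, h0, zero_add]
  have hw0 : w 0 = Y i.castSucc := by simp [hw]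
  constructor
  · rintro ⟨v, hv⟩
    have hconst : ∀ τ ∈ Set.Icc (0 : ℝ) 1, (v - w) τ = (v - w) 0 := by
      have hd : ∀ τ ∈ Set.Icc (0 : ℝ) 1, HasDerivWithinAt (v - w) 0 (Set.Icc 0 1) τ :=
          fun τ hτ => by
        simpa using (hv.deriv τ hτ).sub (hwd τ (v τ)).hasDerivWithinAt
      intro τ hτ
      have h := (convex_Icc (0 : ℝ) 1).norm_image_sub_le_of_norm_hasDerivWithin_le (C := 0) hd
        (by simp) (Set.left_mem_Icc.2 zero_le_one) hτ
      exact sub_eq_zero.1 (norm_le_zero_iff.1 (by simpa using h))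
    have h1 := hconst 1 (Set.right_mem_Icc.2 zero_le_one)
    simp only [Pi.sub_apply, hv.init, hw0, sub_self] at h1
    rw [hv.final, sub_eq_zero.1 h1]
  · exact fun h => ⟨w, hw0, fun τ _ => (hwd τ _).hasDerivWithinAt, h⟩

/-- Without a fast field the method is its slow base scheme. -/
theorem step_zero_iff (M : MRIGARK s m)
    (fS : ℝ → EuclideanSpace ℝ (Fin d) → EuclideanSpace ℝ (Fin d)) (t₀ : ℝ)
    (y₀ : EuclideanSpace ℝ (Fin d)) {H : ℝ} (hH : 0 < H)
    (Y : Fin (s + 1) → EuclideanSpace ℝ (Fin d)) (y₁ : EuclideanSpace ℝ (Fin d)) :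
    M.Step (fun _ _ => 0) fS t₀ y₀ H Y y₁ ↔
      M.base.Step fS t₀ y₀ H (fun i => Y i.castSucc) y₁ ∧ y₁ = Y (Fin.last s) := by
  rw [step_iff_isStage M _ _ _ _ hH]
  simp only [exists_isStage_iff M _ fS t₀ H Y _ (fun _ _ => smul_zero _)]
  set g : Fin s → EuclideanSpace ℝ (Fin d) := fun j => fS (t₀ + H * M.base.c j) (Y j.castSucc)
    with hg
  have hA : ∀ i, H • ∑ j, M.base.A i j • g j =
      ∑ l, if l < i then H • ∑ j, M.gammaInt l j 1 • g j else 0 := by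
    intro i
    simp only [base_A_apply, Finset.sum_smul, Finset.smul_sum, ite_smul, zero_smul]
    rw [Finset.sum_comm]
    refine Finset.sum_congr rfl fun l _ => ?_
    split_ifs <;> simp
  have hb : H • ∑ j, M.base.b j • g j = ∑ l, H • ∑ j, M.gammaInt l j 1 • g j := by
    simp only [base_b_apply, Finset.sum_smul, Finset.smul_sum]
    rw [Finset.sum_comm]
  have hstep : M.base.Step fS t₀ y₀ H (fun i => Y i.castSucc) y₁ ↔
      (∀ i : Fin s, Y i.castSucc = y₀ + H • ∑ j, M.base.A i j • g j) ∧
        y₁ = y₀ + H • ∑ j, M.base.b j • g j := by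
    simp only [RKMethod.Step, hg, mul_comm H (M.base.c _)]
  rw [hstep]
  constructor
  · rintro ⟨h0, hr, hy⟩
    have hq : ∀ l : Fin s, Y l.succ - Y l.castSucc = H • ∑ j, M.gammaInt l j 1 • g j := fun l => by
      rw [hr l, add_sub_cancel_left]
    refine ⟨⟨fun i => ?_, ?_⟩, hy⟩
    · have h := Fin.sum_filter_succ_sub_castSucc Y i.castSucc
      simp only [Fin.castSucc_lt_castSucc_iff, hq, ← hA, h0] at h
      rw [h, add_sub_cancel]
    · have h := Fin.sum_succ_sub_castSucc Y
      simp only [hq, ← hb, h0] at h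
      rw [h, hy, add_sub_cancel]
  · rintro ⟨⟨hY, hy⟩, hl⟩
    have hX : ∀ i : Fin (s + 1), Y i = y₀ +
        ∑ l : Fin s, if l.castSucc < i then H • ∑ j, M.gammaInt l j 1 • g j else 0 := by
      intro i
      induction i using Fin.lastCases with
      | cast i => simp only [Fin.castSucc_lt_castSucc_iff, ← hA]; exact hY i
      | last => simp only [Fin.castSucc_lt_last, if_true, ← hb]; rw [← hl, hy]
    refine ⟨by simpa using hX 0, fun i => ?_, hl⟩
    rw [hX i.succ, hX i.castSucc, Fin.sum_filter_castSucc_lt_succ, add_assoc]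

theorem InternallyConsistent.c_nonneg {M : MRIGARK s m} (hM : M.InternallyConsistent)
    (i : Fin s) : 0 ≤ M.base.c i := by
  have h := hM.node_zero i
  have h0 : (0 : Fin (s + 1)) = (⟨0, i.pos⟩ : Fin s).castSucc := rfl
  rw [h0, RKMethod.node_castSucc] at h
  rw [← h]
  exact M.abscissae_mono (Fin.mk_le_of_le_val (Nat.zero_le _))

theorem InternallyConsistent.time_mem {M : MRIGARK s m} (hM : M.InternallyConsistent)
    {t₀ δ H : ℝ} (hH : 0 ≤ H) (hHδ : H ≤ δ) (i : Fin s) :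
    t₀ + H * M.base.c i ∈ Set.Icc t₀ (t₀ + δ) := by
  have h0 := hM.c_nonneg i
  have h1 := M.abscissae_le_one i
  constructor <;> nlinarith

/-- The slow base scheme inherits the order, since it is the method without a fast field. -/
theorem HasOrder.base {M : MRIGARK s m} (hM : M.InternallyConsistent) {p : ℕ}
    (h : M.HasOrder p) : M.base.HasOrder p := by
  intro d f hf t₀ δ y hδ hy
  obtain ⟨H₀, hH₀, r, hr, C, hC⟩ := h d (fun _ _ => 0) f contDiff_const hf t₀ δ y hδ
    (by simpa [IsExactSolution] using hy)
  obtain ⟨K, hK⟩ := hf.exists_fieldBound t₀ δ hδ.le (y t₀) r hr.le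
  -- for small steps the result is also near the initial value
  set N := (∑ j, |M.base.b j|) * K + 1 with hN
  have hN0 : 0 < N := by have := hK.nonneg; positivity
  refine ⟨min H₀ (r / N), ⟨lt_min hH₀.1 (by positivity), (min_le_left _ _).trans hH₀.2⟩, r, hr, C,
    fun H hH => ?_⟩
  have hHH₀ : H ∈ Set.Ioc 0 H₀ := ⟨hH.1, hH.2.trans (min_le_left _ _)⟩
  have hHr : H * N ≤ r := (le_div_iff₀ hN0).1 (hH.2.trans (min_le_right _ _))
  obtain ⟨⟨Y, y₁, hY, hs⟩, hall⟩ := hC H hHH₀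
  refine ⟨⟨fun i => Y i.castSucc, y₁, fun i => hY _, ((step_zero_iff M f t₀ _ hH.1 Y y₁).1 hs).1⟩,
    fun Y y₁ hY hs => ?_⟩
  refine hall (Fin.snoc Y y₁) y₁ ?_
    ((step_zero_iff M f t₀ _ hH.1 _ y₁).2 ⟨by simpa using hs, by simp⟩)
  intro i
  induction i using Fin.lastCases with
  | cast i => simpa using hY i
  | last =>
    rw [Fin.snoc_last, mem_closedBall_iff_norm, hs.2, add_sub_cancel_left, norm_smul,
      Real.norm_of_nonneg hH.1.le]
    refine (mul_le_mul_of_nonneg_left ?_ hH.1.le).trans hHr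
    refine (norm_sum_le _ _).trans ?_
    rw [hN, Finset.sum_mul]
    refine (Finset.sum_le_sum fun j _ => ?_).trans (le_add_of_nonneg_right zero_le_one)
    rw [norm_smul, Real.norm_eq_abs]
    refine mul_le_mul_of_nonneg_left (hK.norm_le _ ?_ _ (hY j)) (abs_nonneg _)
    rw [mul_comm]
    exact hM.time_mem hH.1.le (hHH₀.2.trans hH₀.2) j

end MRIGARK

/-! ### Existence of small steps -/

theorem FieldBound.mono {d : ℕ} {f : ℝ → EuclideanSpace ℝ (Fin d) → EuclideanSpace ℝ (Fin d)}
    {t₀ δ ρ K K' : ℝ} {x₀ : EuclideanSpace ℝ (Fin d)}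
    {A : EuclideanSpace ℝ (Fin d) →L[ℝ] EuclideanSpace ℝ (Fin d)}
    (h : FieldBound f t₀ δ x₀ ρ K A) (hK : K ≤ K') : FieldBound f t₀ δ x₀ ρ K' A where
  nonneg := h.nonneg.trans hK
  norm_le t ht x hx := (h.norm_le t ht x hx).trans hK
  lipschitz t ht x hx z hz := (h.lipschitz t ht x hx z hz).trans (by gcongr)
  linear t ht x hx z hz := (h.linear t ht x hx z hz).trans (by
    have := sub_nonneg.2 ht.1
    gcongr)

namespace MRIGARK

variable {s m d : ℕ}

theorem deltaC_nonneg (M : MRIGARK s m) (i : Fin s) : 0 ≤ M.base.deltaC i := by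
  unfold RKMethod.deltaC
  split_ifs with h
  · exact sub_nonneg.2 (M.abscissae_mono (Fin.mk_le_of_le_val (Nat.le_succ _)))
  · exact sub_nonneg.2 (M.abscissae_le_one i)

theorem InternallyConsistent.node_mem {M : MRIGARK s m} (hM : M.InternallyConsistent)
    (i : Fin (s + 1)) : M.base.node i ∈ Set.Icc (0 : ℝ) 1 := by
  induction i using Fin.lastCases with
  | cast i => simpa using ⟨hM.c_nonneg i, M.abscissae_le_one i⟩
  | last => simp

theorem InternallyConsistent.deltaC_le_one {M : MRIGARK s m} (hM : M.InternallyConsistent)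
    (i : Fin s) : M.base.deltaC i ≤ 1 := by
  have h1 := (hM.node_mem i.succ).2
  have h2 := hM.c_nonneg i
  rw [RKMethod.node_succ] at h1
  linarith

theorem InternallyConsistent.c_add_mem {M : MRIGARK s m} (hM : M.InternallyConsistent)
    (i : Fin s) {τ : ℝ} (hτ : τ ∈ Set.Icc (0 : ℝ) 1) :
    M.base.c i + M.base.deltaC i * τ ∈ Set.Icc (0 : ℝ) 1 := by
  have h1 := (hM.node_mem i.succ).2
  rw [RKMethod.node_succ] at h1
  have h2 := hM.c_nonneg i
  have h3 := M.deltaC_nonneg i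
  exact ⟨add_nonneg h2 (mul_nonneg h3 hτ.1), by nlinarith [hτ.2]⟩

theorem exists_gamma_bound (M : MRIGARK s m) : ∃ N, 0 ≤ N ∧
    (∀ i, ∀ τ ∈ Set.Icc (0 : ℝ) 1, ∑ j, |M.gamma i j τ| ≤ N) ∧
    ∀ i, ∑ j, |M.gammaInt i j 1| ≤ N := by
  refine ⟨∑ i, ∑ j, ∑ k, |M.Γ k i j|, by positivity, fun i τ hτ => ?_, fun i => ?_⟩
  · refine le_trans (Finset.sum_le_sum fun j _ => ?_) (Finset.single_le_sum
      (f := fun i => ∑ j, ∑ k, |M.Γ k i j|) (fun _ _ => by positivity) (Finset.mem_univ i))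
    refine (Finset.abs_sum_le_sum_abs _ _).trans (Finset.sum_le_sum fun k _ => ?_)
    rw [abs_mul, abs_of_nonneg (pow_nonneg hτ.1 _)]
    exact mul_le_of_le_one_right (abs_nonneg _) (pow_le_one₀ hτ.1 hτ.2)
  · refine le_trans (Finset.sum_le_sum fun j _ => ?_) (Finset.single_le_sum
      (f := fun i => ∑ j, ∑ k, |M.Γ k i j|) (fun _ _ => by positivity) (Finset.mem_univ i))
    refine (Finset.abs_sum_le_sum_abs _ _).trans (Finset.sum_le_sum fun k _ => ?_)
    rw [abs_mul, one_pow, abs_of_nonneg (a := 1 / ((k.val : ℝ) + 1)) (by positivity)]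
    refine mul_le_of_le_one_right (abs_nonneg _) ((div_le_one (by positivity)).2 ?_)
    have : (0 : ℝ) ≤ k.val := by positivity
    linarith

/-- The uniform bounds behind the analysis of a step: both fields are controlled by `K` on a
cylinder of radius `ρ`, and the slow tendency coefficients by `N`. -/
structure StepBound (M : MRIGARK s m)
    (fF fS : ℝ → EuclideanSpace ℝ (Fin d) → EuclideanSpace ℝ (Fin d)) (t₀ δ : ℝ)
    (x₀ : EuclideanSpace ℝ (Fin d)) (ρ K N : ℝ)
    (AF AS : EuclideanSpace ℝ (Fin d) →L[ℝ] EuclideanSpace ℝ (Fin d)) : Prop where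
  consistent : M.InternallyConsistent
  fast : FieldBound fF t₀ δ x₀ ρ K AF
  slow : FieldBound fS t₀ δ x₀ ρ K AS
  nonneg : 0 ≤ N
  gamma_le : ∀ i, ∀ τ ∈ Set.Icc (0 : ℝ) 1, ∑ j, |M.gamma i j τ| ≤ N
  gammaInt_le : ∀ i, ∑ j, |M.gammaInt i j 1| ≤ N

variable {M : MRIGARK s m} {fF fS : ℝ → EuclideanSpace ℝ (Fin d) → EuclideanSpace ℝ (Fin d)}
  {t₀ δ ρ r K N H : ℝ} {x₀ : EuclideanSpace ℝ (Fin d)}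
  {AF AS : EuclideanSpace ℝ (Fin d) →L[ℝ] EuclideanSpace ℝ (Fin d)}
  {Y : Fin (s + 1) → EuclideanSpace ℝ (Fin d)}

theorem exists_stepBound (hM : M.InternallyConsistent) (hF : IsSmoothField fF)
    (hS : IsSmoothField fS) (t₀ : ℝ) (hδ : 0 < δ) (x₀ : EuclideanSpace ℝ (Fin d)) (hρ : 0 ≤ ρ) :
    ∃ K N, M.StepBound fF fS t₀ δ x₀ ρ K N (fderiv ℝ (fF t₀) x₀) (fderiv ℝ (fS t₀) x₀) := by
  obtain ⟨KF, hKF⟩ := hF.exists_fieldBound t₀ δ hδ.le x₀ ρ hρ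
  obtain ⟨KS, hKS⟩ := hS.exists_fieldBound t₀ δ hδ.le x₀ ρ hρ
  obtain ⟨N, hN, hN1, hN2⟩ := M.exists_gamma_bound
  exact ⟨max KF KS, N, hM, hKF.mono (le_max_left _ _), hKS.mono (le_max_right _ _), hN, hN1, hN2⟩

/-- The bound on the speed of the rescaled stages that `StepBound` yields. It exceeds the supremum
of the stage fields strictly. -/
def speed (K N : ℝ) : ℝ := (1 + N) * K + 1

theorem StepBound.speed_pos (h : M.StepBound fF fS t₀ δ x₀ ρ K N AF AS) : 0 < speed K N := by
  have := h.nonneg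
  have := h.fast.nonneg
  unfold speed
  positivity

theorem StepBound.fast_time_mem (h : M.StepBound fF fS t₀ δ x₀ ρ K N AF AS) (hH : 0 ≤ H)
    (hHδ : H ≤ δ) (i : Fin s) {τ : ℝ} (hτ : τ ∈ Set.Icc (0 : ℝ) 1) :
    t₀ + H * (M.base.c i + M.base.deltaC i * τ) ∈ Set.Icc t₀ (t₀ + δ) := by
  obtain ⟨h0, h1⟩ := h.consistent.c_add_mem i hτ
  constructor <;> nlinarith

theorem StepBound.norm_stageField_lt (h : M.StepBound fF fS t₀ δ x₀ ρ K N AF AS) (hH : 0 < H)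
    (hHδ : H ≤ δ) (hY : ∀ j, Y j ∈ Metric.closedBall x₀ ρ) (i : Fin s) {τ : ℝ}
    (hτ : τ ∈ Set.Icc (0 : ℝ) 1) {x : EuclideanSpace ℝ (Fin d)}
    (hx : x ∈ Metric.closedBall x₀ ρ) :
    ‖M.stageField fF fS t₀ H Y i τ x‖ < H * speed K N := by
  rw [stageField, norm_smul, Real.norm_of_nonneg hH.le]
  refine mul_lt_mul_of_pos_left ?_ hH
  have h1 : ‖M.base.deltaC i • fF (t₀ + H * (M.base.c i + M.base.deltaC i * τ)) x‖ ≤ K := by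
    rw [norm_smul, Real.norm_of_nonneg (M.deltaC_nonneg i)]
    exact (mul_le_of_le_one_left (norm_nonneg _) (h.consistent.deltaC_le_one i)).trans
      (h.fast.norm_le _ (h.fast_time_mem hH.le hHδ i hτ) _ hx)
  have h2 : ‖∑ j, M.gamma i j τ • fS (t₀ + H * M.base.c j) (Y j.castSucc)‖ ≤ N * K := by
    refine ((norm_sum_le _ _).trans (Finset.sum_le_sum (g := fun j => |M.gamma i j τ| * K)
      fun j _ => ?_)).trans ?_
    · rw [norm_smul, Real.norm_eq_abs]
      exact mul_le_mul_of_nonneg_left (h.slow.norm_le _ (h.consistent.time_mem hH.le hHδ j) _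
        (hY _)) (abs_nonneg _)
    · rw [← Finset.sum_mul]
      exact mul_le_mul_of_nonneg_right (h.gamma_le i τ hτ) h.slow.nonneg
  refine (norm_add_le _ _).trans_lt ?_
  unfold speed
  linarith

/-- A stage that starts in the ball of radius `r` stays in the ball of radius `r + 1`, where the
fields are controlled, and moves with bounded speed. -/
theorem StepBound.norm_stage_sub_le (h : M.StepBound fF fS t₀ δ x₀ (r + 1) K N AF AS)
    (hH : 0 < H) (hHδ : H ≤ δ) (hHB : H * speed K N ≤ 1)
    (hY : ∀ j, Y j ∈ Metric.closedBall x₀ (r + 1)) {i : Fin s}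
    (hYi : Y i.castSucc ∈ Metric.closedBall x₀ r) {v : ℝ → EuclideanSpace ℝ (Fin d)}
    (hv0 : v 0 = Y i.castSucc) (hv : ∀ τ ∈ Set.Icc (0 : ℝ) 1,
      HasDerivWithinAt v (M.stageField fF fS t₀ H Y i τ (v τ)) (Set.Icc 0 1) τ)
    {τ : ℝ} (hτ : τ ∈ Set.Icc (0 : ℝ) 1) : ‖v τ - Y i.castSucc‖ ≤ H * speed K N := by
  have hBp := h.speed_pos
  have key := image_norm_le_of_norm_deriv_right_lt_deriv_boundary'
    (f := fun τ => v τ - Y i.castSucc) (f' := fun τ => M.stageField fF fS t₀ H Y i τ (v τ))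
    (a := 0) (b := 1) (B := fun τ => H * speed K N * τ) (B' := fun _ => H * speed K N)
    (fun σ hσ => (hv σ hσ).continuousWithinAt.sub continuousWithinAt_const)
    (fun σ hσ => ((hv σ ⟨hσ.1, hσ.2.le⟩).sub_const _).mono_of_mem_nhdsWithin
      (Icc_mem_nhdsGE_of_mem hσ))
    (by simp [hv0]) (by fun_prop)
    (fun σ _ => by simpa using (hasDerivWithinAt_id σ (Set.Ici σ)).const_mul (H * speed K N))
    (fun σ hσ hn => h.norm_stageField_lt hH hHδ hY i ⟨hσ.1, hσ.2.le⟩ ?_) hτ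
  · exact key.trans (mul_le_of_le_one_right (by positivity) hτ.2)
  · rw [mem_closedBall_iff_norm] at hYi ⊢
    have h1 : H * speed K N * σ ≤ 1 := mul_le_one₀ hHB hσ.1 hσ.2.le
    calc ‖v σ - x₀‖ = ‖(v σ - Y i.castSucc) + (Y i.castSucc - x₀)‖ := by congr 1; abel
      _ ≤ ‖v σ - Y i.castSucc‖ + ‖Y i.castSucc - x₀‖ := norm_add_le _ _
      _ ≤ r + 1 := by rw [hn]; linarith

theorem StepBound.norm_isStage_sub_le (h : M.StepBound fF fS t₀ δ x₀ (r + 1) K N AF AS)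
    (hH : 0 < H) (hHδ : H ≤ δ) (hHB : H * speed K N ≤ 1)
    (hY : ∀ j, Y j ∈ Metric.closedBall x₀ r) {i : Fin s} {v : ℝ → EuclideanSpace ℝ (Fin d)}
    (hv : M.IsStage fF fS t₀ H Y i v) {τ : ℝ} (hτ : τ ∈ Set.Icc (0 : ℝ) 1) :
    ‖v τ - Y i.castSucc‖ ≤ H * speed K N :=
  h.norm_stage_sub_le hH hHδ hHB
    (fun j => Metric.closedBall_subset_closedBall (by linarith) (hY j)) (hY _) hv.init hv.deriv hτ

/-- An explicit fast system has a solution on the whole stage, by the Picard–Lindelöf theorem. -/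
theorem StepBound.exists_explicit_stage (h : M.StepBound fF fS t₀ δ x₀ (r + 1) K N AF AS)
    (hF : IsSmoothField fF) (hH : 0 < H) (hHδ : H ≤ δ) (hHB : H * speed K N ≤ 1)
    (hY : ∀ j, Y j ∈ Metric.closedBall x₀ (r + 1)) {i : Fin s}
    (hYi : Y i.castSucc ∈ Metric.closedBall x₀ r) :
    ∃ v : ℝ → EuclideanSpace ℝ (Fin d), v 0 = Y i.castSucc ∧ ∀ τ ∈ Set.Icc (0 : ℝ) 1,
      HasDerivWithinAt v (M.stageField fF fS t₀ H Y i τ (v τ)) (Set.Icc 0 1) τ := by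
  have hsub : Metric.closedBall (Y i.castSucc) 1 ⊆ Metric.closedBall x₀ (r + 1) :=
    Metric.closedBall_subset_closedBall' (by rw [Metric.mem_closedBall] at hYi; linarith)
  obtain ⟨L, hL⟩ : ∃ L : NNReal, (L : ℝ) = H * speed K N :=
    ⟨⟨_, (mul_pos hH h.speed_pos).le⟩, rfl⟩
  obtain ⟨L', hL'⟩ : ∃ L' : NNReal, (L' : ℝ) = H * K :=
    ⟨⟨_, mul_nonneg hH.le h.fast.nonneg⟩, rfl⟩
  have hPL : IsPicardLindelof (M.stageField fF fS t₀ H Y i)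
      (⟨0, Set.left_mem_Icc.2 zero_le_one⟩ : Set.Icc (0 : ℝ) 1) (Y i.castSucc) 1 0 L L' := by
    refine ⟨fun τ hτ => LipschitzOnWith.of_dist_le_mul fun x hx z hz => ?_, fun x _ => ?_,
      fun τ hτ x hx => hL ▸ (h.norm_stageField_lt hH hHδ hY i hτ (hsub hx)).le,
      by simpa [hL] using hHB⟩
    · rw [dist_eq_norm, dist_eq_norm]
      simp only [stageField, ← smul_sub, add_sub_add_right_eq_sub, norm_smul, hL']
      rw [Real.norm_of_nonneg hH.le, Real.norm_of_nonneg (M.deltaC_nonneg i), mul_assoc]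
      refine mul_le_mul_of_nonneg_left ?_ hH.le
      exact (mul_le_of_le_one_left (norm_nonneg _) (h.consistent.deltaC_le_one i)).trans
        (h.fast.lipschitz _ (h.fast_time_mem hH.le hHδ i hτ) _ (hsub hx) _ (hsub hz))
    · have h1 : Continuous fun τ : ℝ => fF (t₀ + H * (M.base.c i + M.base.deltaC i * τ)) x :=
        hF.continuous.comp (f := fun τ : ℝ =>
          (t₀ + H * (M.base.c i + M.base.deltaC i * τ), x)) (by fun_prop)
      have h2 : Continuous fun τ : ℝ =>
          ∑ j, M.gamma i j τ • fS (t₀ + H * M.base.c j) (Y j.castSucc) :=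
        continuous_finsetSum _ fun j _ => (M.continuous_gamma i j).smul continuous_const
      have h3 : Continuous fun τ : ℝ => M.stageField fF fS t₀ H Y i τ x := by
        unfold stageField
        exact ((h1.const_smul (M.base.deltaC i)).add h2).const_smul H
      exact h3.continuousOn
  exact hPL.exists_eq_forall_mem_Icc_hasDerivWithinAt₀

/-- The new stage value of stage `i` exists. If the abscissa moves, the fast system is explicit;
otherwise the stage value is the fixed point of a contraction. -/
theorem StepBound.exists_update_isStage (h : M.StepBound fF fS t₀ δ x₀ (r + 1) K N AF AS)
    (hF : IsSmoothField fF) (hH : 0 < H) (hHδ : H ≤ δ) (hHB : H * speed K N ≤ 1)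
    (hHK : H * (N * K) ≤ 1 / 2) (hY : ∀ j, Y j ∈ Metric.closedBall x₀ r) (i : Fin s) :
    ∃ z, ‖z - Y i.castSucc‖ ≤ H * speed K N ∧
      ∃ v, M.IsStage fF fS t₀ H (Function.update Y i.succ z) i v := by
  have hcs : ∀ z, Function.update Y i.succ z i.castSucc = Y i.castSucc := fun z =>
    Function.update_of_ne (Fin.castSucc_lt_succ).ne _ _
  have hY' : ∀ j, Y j ∈ Metric.closedBall x₀ (r + 1) := fun j =>
    Metric.closedBall_subset_closedBall (by linarith) (hY j)
  by_cases hΔ : M.base.deltaC i = 0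
  · have hsub : Metric.closedBall (Y i.castSucc) 1 ⊆ Metric.closedBall x₀ (r + 1) :=
      Metric.closedBall_subset_closedBall' (by
        have := hY i.castSucc; rw [Metric.mem_closedBall] at this; linarith)
    have hupd : ∀ z ∈ Metric.closedBall (Y i.castSucc) 1, ∀ j,
        Function.update Y i.succ z j ∈ Metric.closedBall x₀ (r + 1) := by
      intro z hz j
      by_cases hj : j = i.succ
      · subst hj; simpa using hsub hz
      · simpa [hj] using hY' j
    set T : EuclideanSpace ℝ (Fin d) → EuclideanSpace ℝ (Fin d) := fun z => Y i.castSucc +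
      H • ∑ j, M.gammaInt i j 1 • fS (t₀ + H * M.base.c j) (Function.update Y i.succ z j.castSucc)
      with hT
    have hsum : ∀ w : Fin s → EuclideanSpace ℝ (Fin d), ∀ L : ℝ, 0 ≤ L → (∀ j, ‖w j‖ ≤ K * L) →
        ‖H • ∑ j, M.gammaInt i j 1 • w j‖ ≤ H * (N * K) * L := by
      intro w L hL hw
      rw [norm_smul, Real.norm_of_nonneg hH.le, mul_assoc, mul_assoc]
      refine mul_le_mul_of_nonneg_left ?_ hH.le
      refine ((norm_sum_le _ _).trans (Finset.sum_le_sum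
        (g := fun j => |M.gammaInt i j 1| * (K * L)) fun j _ => ?_)).trans ?_
      · rw [norm_smul, Real.norm_eq_abs]
        exact mul_le_mul_of_nonneg_left (hw j) (abs_nonneg _)
      · rw [← Finset.sum_mul]
        exact mul_le_mul_of_nonneg_right (h.gammaInt_le i) (mul_nonneg h.slow.nonneg hL)
    have hTn : ∀ z ∈ Metric.closedBall (Y i.castSucc) 1, ‖T z - Y i.castSucc‖ ≤ H * (N * K) := by
      intro z hz
      rw [hT, add_sub_cancel_left]
      refine (hsum _ 1 zero_le_one fun j => ?_).trans (by rw [mul_one])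
      rw [mul_one]
      exact h.slow.norm_le _ (h.consistent.time_mem hH.le hHδ j) _ (hupd z hz _)
    have hmaps : Set.MapsTo T (Metric.closedBall (Y i.castSucc) 1)
        (Metric.closedBall (Y i.castSucc) 1) := fun z hz => by
      rw [mem_closedBall_iff_norm]
      exact (hTn z hz).trans (by linarith)
    have hcontr : ContractingWith (1 / 2) (hmaps.restrict T _ _) := by
      refine ⟨by rw [← NNReal.coe_lt_coe]; norm_num, LipschitzWith.of_dist_le_mul fun z w => ?_⟩
      have h1 : dist (T z) (T w) ≤ H * (N * K) * ‖(z : EuclideanSpace ℝ (Fin d)) - w‖ := by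
        rw [dist_eq_norm, hT, add_sub_add_left_eq_sub, ← smul_sub, ← Finset.sum_sub_distrib]
        simp only [← smul_sub]
        refine hsum _ _ (norm_nonneg _) fun j => ?_
        refine (h.slow.lipschitz _ (h.consistent.time_mem hH.le hHδ j) _ (hupd z z.2 _) _
          (hupd w w.2 _)).trans (mul_le_mul_of_nonneg_left ?_ h.slow.nonneg)
        by_cases hj : j.castSucc = i.succ
        · rw [hj]; simp
        · simp [hj]
      refine h1.trans ?_
      rw [Subtype.dist_eq, dist_eq_norm]
      exact mul_le_mul_of_nonneg_right (by push_cast; exact hHK) (norm_nonneg _)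
    obtain ⟨z, hz, hfix, -⟩ := hcontr.exists_fixedPoint'
      Metric.isClosed_closedBall.isComplete hmaps (Metric.mem_closedBall_self zero_le_one)
      (edist_ne_top _ _)
    refine ⟨z, ?_, (M.exists_isStage_iff fF fS t₀ H _ i (by simp [hΔ])).2 ?_⟩
    · have h1 := hTn z hz
      rw [hfix.eq] at h1
      refine h1.trans (mul_le_mul_of_nonneg_left ?_ hH.le)
      have := h.fast.nonneg
      unfold speed
      linarith
    · rw [Function.update_self, hcs]
      exact hfix.eq.symm
  · have hγ : ∀ j : Fin s, j.castSucc = i.succ → ∀ τ, M.gamma i j τ = 0 := by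
      intro j hj τ
      have hj' : j.val = i.val + 1 := by simpa [Fin.ext_iff] using hj
      refine Finset.sum_eq_zero fun k _ => ?_
      rw [(mul_eq_zero.1 (M.gamma_mul_deltaC k i j hj')).resolve_right hΔ, zero_mul]
    have hfield : ∀ z τ x, M.stageField fF fS t₀ H (Function.update Y i.succ z) i τ x =
        M.stageField fF fS t₀ H Y i τ x := by
      intro z τ x
      unfold stageField
      congr 2
      refine Finset.sum_congr rfl fun j _ => ?_
      by_cases hj : j.castSucc = i.succ
      · rw [hγ j hj, zero_smul, zero_smul]
      · rw [Function.update_of_ne hj]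
    obtain ⟨v, hv0, hv⟩ := h.exists_explicit_stage hF hH hHδ hHB hY' (hY i.castSucc)
    refine ⟨v 1, h.norm_stage_sub_le hH hHδ hHB hY' (hY _) hv0 hv (Set.right_mem_Icc.2 zero_le_one),
      v, ?_, fun τ hτ => ?_, by simp⟩
    · rw [hv0, hcs]
    · rw [hfield]; exact hv τ hτ

/-- Earlier stages do not see a later stage value. -/
theorem IsStage.update {i k : Fin s} (hik : i < k) {v : ℝ → EuclideanSpace ℝ (Fin d)}
    (hv : M.IsStage fF fS t₀ H Y i v) (z : EuclideanSpace ℝ (Fin d)) :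
    M.IsStage fF fS t₀ H (Function.update Y k.succ z) i v := by
  have h1 : i.castSucc ≠ k.succ := (Fin.castSucc_lt_succ_iff.2 hik.le).ne
  have h2 : i.succ ≠ k.succ := fun h => hik.ne (Fin.succ_injective _ h)
  refine ⟨by rw [Function.update_of_ne h1, hv.init], fun τ hτ => ?_,
    by rw [Function.update_of_ne h2, hv.final]⟩
  refine (hv.deriv τ hτ).congr_deriv ?_
  unfold stageField
  congr 2
  refine Finset.sum_congr rfl fun j _ => ?_
  by_cases hj : j.castSucc = k.succ
  · have hj' : j.val = k.val + 1 := by simpa [Fin.ext_iff] using hj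
    have hγ : M.gamma i j τ = 0 := Finset.sum_eq_zero fun l _ => by
      rw [M.gamma_eq_zero l i j (by have := Fin.lt_def.1 hik; omega), zero_mul]
    rw [hγ, zero_smul, zero_smul]
  · rw [Function.update_of_ne hj]

/-- A step with all stages in the ball of radius `r` exists once the step size is small. -/
theorem StepBound.exists_step (h : M.StepBound fF fS t₀ δ x₀ (r + 1) K N AF AS)
    (hF : IsSmoothField fF) (hH : 0 < H) (hHδ : H ≤ δ) (hHB : H * speed K N ≤ 1)
    (hHK : H * (N * K) ≤ 1 / 2) (hHr : s * (H * speed K N) ≤ r) :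
    ∃ Y y₁, (∀ i, Y i ∈ Metric.closedBall x₀ r) ∧ M.Step fF fS t₀ x₀ H Y y₁ := by
  have hBp := mul_pos hH h.speed_pos
  suffices hk : ∀ k ≤ s, ∃ Y : Fin (s + 1) → EuclideanSpace ℝ (Fin d), Y 0 = x₀ ∧
      (∀ j, ‖Y j - x₀‖ ≤ k * (H * speed K N)) ∧
      ∀ i : Fin s, i.val < k → ∃ v, M.IsStage fF fS t₀ H Y i v by
    obtain ⟨Y, h0, hY, hst⟩ := hk s le_rfl
    exact ⟨Y, Y (Fin.last s), fun i => mem_closedBall_iff_norm.2 ((hY i).trans hHr),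
      (step_iff_isStage M fF fS t₀ x₀ hH Y _).2 ⟨h0, fun i => hst i i.2, rfl⟩⟩
  intro k
  induction k with
  | zero => exact fun _ => ⟨fun _ => x₀, rfl, by simp, by simp⟩
  | succ k ih =>
    intro hks
    obtain ⟨Y, h0, hY, hst⟩ := ih (by omega)
    set i : Fin s := ⟨k, hks⟩ with hi
    have hYr : ∀ j, Y j ∈ Metric.closedBall x₀ r := fun j => by
      rw [mem_closedBall_iff_norm]
      refine ((hY j).trans (mul_le_mul_of_nonneg_right ?_ hBp.le)).trans hHr
      exact_mod_cast (by omega : k ≤ s)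
    obtain ⟨z, hz, hv⟩ := h.exists_update_isStage hF hH hHδ hHB hHK hYr i
    refine ⟨Function.update Y i.succ z, ?_, fun j => ?_, fun l hl => ?_⟩
    · rw [Function.update_of_ne (Fin.succ_ne_zero i).symm, h0]
    · push_cast
      by_cases hj : j = i.succ
      · subst hj
        rw [Function.update_self]
        calc ‖z - x₀‖ = ‖(z - Y i.castSucc) + (Y i.castSucc - x₀)‖ := by congr 1; abel
          _ ≤ ‖z - Y i.castSucc‖ + ‖Y i.castSucc - x₀‖ := norm_add_le _ _
          _ ≤ (k + 1) * (H * speed K N) := by linarith [hY i.castSucc]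
      · rw [Function.update_of_ne hj]
        linarith [hY j]
    · rcases Nat.lt_succ_iff_lt_or_eq.1 hl with hlt | heq
      · obtain ⟨v, hv⟩ := hst l hlt
        exact ⟨v, hv.update (Fin.lt_def.2 hlt) z⟩
      · rw [show l = i from Fin.ext heq]
        exact hv

end MRIGARK

/-! ### Estimates that are uniform over families of steps -/

open Filter in
/-- The filter of pairs (member of a family, time in `[0, 1]`) along which estimates are uniform. -/
def unitTime (ι : Type*) : Filter (ι × ℝ) := 𝓟 (Set.univ ×ˢ Set.Icc (0 : ℝ) 1)

section UniformEstimates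

open Asymptotics

variable {ι E : Type*} [NormedAddCommGroup E]

theorem eventually_unitTime {P : ι × ℝ → Prop} :
    (∀ᶠ p in unitTime ι, P p) ↔ ∀ a, ∀ τ ∈ Set.Icc (0 : ℝ) 1, P (a, τ) := by
  simp [unitTime]

theorem isBigO_unitTime_of_le {f : ι → ℝ → E} {g : ι → ℝ} (C : ℝ)
    (h : ∀ a, ∀ τ ∈ Set.Icc (0 : ℝ) 1, ‖f a τ‖ ≤ C * ‖g a‖) :
    (fun p : ι × ℝ => f p.1 p.2) =O[unitTime ι] fun p => g p.1 :=
  IsBigO.of_bound C (eventually_unitTime.2 h)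

theorem isBigO_unitTime_exists {f : ι → ℝ → E} {g : ι → ℝ}
    (h : (fun p : ι × ℝ => f p.1 p.2) =O[unitTime ι] fun p => g p.1) :
    ∃ C, 0 ≤ C ∧ ∀ a, ∀ τ ∈ Set.Icc (0 : ℝ) 1, ‖f a τ‖ ≤ C * ‖g a‖ := by
  obtain ⟨C, hC0, hC⟩ := h.exists_nonneg
  exact ⟨C, hC0, eventually_unitTime.1 hC.bound⟩

theorem isBigO_unitTime_eval {f : ι → ℝ → E} {g : ι → ℝ} {σ : ℝ} (hσ : σ ∈ Set.Icc (0 : ℝ) 1)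
    (h : (fun p : ι × ℝ => f p.1 p.2) =O[unitTime ι] fun p => g p.1) :
    (fun p : ι × ℝ => f p.1 σ) =O[unitTime ι] fun p => g p.1 := by
  obtain ⟨C, -, hC⟩ := isBigO_unitTime_exists h
  exact isBigO_unitTime_of_le (f := fun a _ => f a σ) C fun a _ _ => hC a σ hσ

/-- A function of time alone that is continuous is uniformly bounded. -/
theorem isBigO_unitTime_one {f : ℝ → ℝ} (hf : Continuous f) :
    (fun p : ι × ℝ => f p.2) =O[unitTime ι] fun _ => (1 : ℝ) := by
  obtain ⟨C, hC⟩ := isCompact_Icc.exists_bound_of_continuousOn (s := Set.Icc (0 : ℝ) 1)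
    hf.continuousOn
  exact IsBigO.of_bound C (eventually_unitTime.2 fun a τ hτ => by simpa using hC τ hτ)

variable [NormedSpace ℝ E]

theorem isBigO_unitTime_sub_of_deriv {w w' : ι → ℝ → E} {g : ι → ℝ}
    (hd : ∀ a, ∀ τ ∈ Set.Icc (0 : ℝ) 1, HasDerivWithinAt (w a) (w' a τ) (Set.Icc 0 1) τ)
    (h : (fun p : ι × ℝ => w' p.1 p.2) =O[unitTime ι] fun p => g p.1) :
    (fun p : ι × ℝ => w p.1 p.2 - w p.1 0) =O[unitTime ι] fun p => g p.1 := by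
  obtain ⟨C, hC0, hC⟩ := isBigO_unitTime_exists h
  refine isBigO_unitTime_of_le (f := fun a τ => w a τ - w a 0) C fun a τ hτ => ?_
  refine ((convex_Icc (0 : ℝ) 1).norm_image_sub_le_of_norm_hasDerivWithin_le (hd a) (hC a)
    (Set.left_mem_Icc.2 zero_le_one) hτ).trans ?_
  rw [sub_zero, Real.norm_of_nonneg hτ.1]
  exact mul_le_of_le_one_right (by positivity) hτ.2

/-- Estimates of the derivative propagate through consecutive stages. -/
theorem isBigO_unitTime_stages {s : ℕ} {X : ι → Fin (s + 1) → E} {w w' : ι → Fin s → ℝ → E}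
    {g : ι → ℝ} (hw0 : ∀ a i, w a i 0 = X a i.castSucc) (hw1 : ∀ a i, w a i 1 = X a i.succ)
    (hd : ∀ a i, ∀ τ ∈ Set.Icc (0 : ℝ) 1, HasDerivWithinAt (w a i) (w' a i τ) (Set.Icc 0 1) τ)
    (h0 : ∀ a, X a 0 = 0)
    (h : ∀ i, (fun p : ι × ℝ => w' p.1 i p.2) =O[unitTime ι] fun p => g p.1) :
    (∀ i, (fun p : ι × ℝ => X p.1 i) =O[unitTime ι] fun p => g p.1) ∧
      ∀ i, (fun p : ι × ℝ => w p.1 i p.2) =O[unitTime ι] fun p => g p.1 := by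
  have hsub : ∀ i, (fun p : ι × ℝ => w p.1 i p.2 - X p.1 i.castSucc) =O[unitTime ι]
      fun p => g p.1 := fun i => by
    simpa only [hw0] using isBigO_unitTime_sub_of_deriv (w := fun a => w a i)
      (w' := fun a => w' a i) (fun a => hd a i) (h i)
  have hX : ∀ i, (fun p : ι × ℝ => X p.1 i) =O[unitTime ι] fun p => g p.1 := by
    intro i
    induction i using Fin.induction with
    | zero => simpa only [h0] using isBigO_zero _ _
    | succ i ih =>
      have h1 := isBigO_unitTime_eval (f := fun a τ => w a i τ - X a i.castSucc)
        (Set.right_mem_Icc.2 zero_le_one) (hsub i)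
      simpa only [hw1, sub_add_cancel] using h1.add ih
  exact ⟨hX, fun i => by simpa only [sub_add_cancel] using (hsub i).add (hX i.castSucc)⟩

end UniformEstimates

/-! ### Errors along a family of steps -/

namespace MRIGARK

open Asymptotics

variable {s m d : ℕ}

/-- A family, indexed by `ι`, of steps of the method along one exact solution `y`, with step sizes
`H` so small that all stages stay where the fields are controlled. The vectors `φ₀`, `φ₁`, `φ₂` are
the Taylor coefficients of the slow field along `y`. -/
structure StepFamily (M : MRIGARK s m)
    (fF fS : ℝ → EuclideanSpace ℝ (Fin d) → EuclideanSpace ℝ (Fin d)) (ι : Type*) where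
  (t₀ δ r K N Ky Kφ : ℝ)
  y : ℝ → EuclideanSpace ℝ (Fin d)
  (AF AS : EuclideanSpace ℝ (Fin d) →L[ℝ] EuclideanSpace ℝ (Fin d))
  (φ₀ φ₁ φ₂ : EuclideanSpace ℝ (Fin d))
  H : ι → ℝ
  Y : ι → Fin (s + 1) → EuclideanSpace ℝ (Fin d)
  v : ι → Fin s → ℝ → EuclideanSpace ℝ (Fin d)
  node_zero : M.base.node 0 = 0
  bound : M.StepBound fF fS t₀ δ (y t₀) (r + 1) K N AF AS
  isExact : IsExactSolution (fun t x => fF t x + fS t x) t₀ δ y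
  y_le : ∀ h ∈ Set.Icc 0 δ, ‖y (t₀ + h) - y t₀‖ ≤ Ky * h
  φ_le : ∀ h ∈ Set.Icc 0 δ,
    ‖fS (t₀ + h) (y (t₀ + h)) - φ₀ - h • φ₁ - h ^ 2 • φ₂‖ ≤ Kφ * h ^ 3
  pos : ∀ a, 0 < H a
  le_one : ∀ a, H a ≤ 1
  le_δ : ∀ a, H a ≤ δ
  speed_le : ∀ a, H a * speed K N ≤ 1
  y_mem : ∀ a, ∀ h ∈ Set.Icc 0 (H a), y (t₀ + h) ∈ Metric.closedBall (y t₀) (r + 1)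
  start : ∀ a, Y a 0 = y t₀
  mem : ∀ a j, Y a j ∈ Metric.closedBall (y t₀) r
  stage : ∀ a i, M.IsStage fF fS t₀ (H a) (Y a) i (v a i)

namespace StepFamily

variable {M : MRIGARK s m} {fF fS : ℝ → EuclideanSpace ℝ (Fin d) → EuclideanSpace ℝ (Fin d)}
  {ι : Type*} (𝔉 : StepFamily M fF fS ι)

/-- The slow field along the exact solution, as a function of the elapsed time. -/
def φ (h : ℝ) : EuclideanSpace ℝ (Fin d) := fS (𝔉.t₀ + h) (𝔉.y (𝔉.t₀ + h))

/-- The time elapsed at the rescaled time `τ` of stage `i`. -/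
def elapsed (a : ι) (i : Fin s) (τ : ℝ) : ℝ := 𝔉.H a * (M.base.c i + M.base.deltaC i * τ)

/-- The error in the course of stage `i`. -/
def err (a : ι) (i : Fin s) (τ : ℝ) : EuclideanSpace ℝ (Fin d) :=
  𝔉.v a i τ - 𝔉.y (𝔉.t₀ + 𝔉.elapsed a i τ)

/-- The error of the stage values. -/
def nodeErr (a : ι) (j : Fin (s + 1)) : EuclideanSpace ℝ (Fin d) :=
  𝔉.Y a j - 𝔉.y (𝔉.t₀ + 𝔉.H a * M.base.node j)

/-- The defect of the fast field in the course of stage `i`. -/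
def fastDefect (a : ι) (i : Fin s) (τ : ℝ) : EuclideanSpace ℝ (Fin d) :=
  fF (𝔉.t₀ + 𝔉.elapsed a i τ) (𝔉.v a i τ) -
    fF (𝔉.t₀ + 𝔉.elapsed a i τ) (𝔉.y (𝔉.t₀ + 𝔉.elapsed a i τ))

/-- The defect of the slow field at stage `j`. -/
def slowDefect (a : ι) (j : Fin s) : EuclideanSpace ℝ (Fin d) :=
  fS (𝔉.t₀ + 𝔉.H a * M.base.c j) (𝔉.Y a j.castSucc) - 𝔉.φ (𝔉.H a * M.base.c j)

/-- The difference between the slow tendency that stage `i` forms from the values of `R` at the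
abscissae, and the values of `R` in the course of the stage. -/
def tendency (R : ℝ → EuclideanSpace ℝ (Fin d)) (a : ι) (i : Fin s) (τ : ℝ) :
    EuclideanSpace ℝ (Fin d) :=
  ∑ j, M.gamma i j τ • R (𝔉.H a * M.base.c j) - M.base.deltaC i • R (𝔉.elapsed a i τ)

theorem elapsed_mem (a : ι) (i : Fin s) {τ : ℝ} (hτ : τ ∈ Set.Icc (0 : ℝ) 1) :
    𝔉.elapsed a i τ ∈ Set.Icc 0 (𝔉.H a) := by
  obtain ⟨h0, h1⟩ := 𝔉.bound.consistent.c_add_mem i hτ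
  have := (𝔉.pos a).le
  exact ⟨mul_nonneg this h0, mul_le_of_le_one_right this h1⟩

theorem slow_time_mem (a : ι) (j : Fin s) : 𝔉.H a * M.base.c j ∈ Set.Icc 0 (𝔉.H a) := by
  have := (𝔉.pos a).le
  exact ⟨mul_nonneg this (𝔉.bound.consistent.c_nonneg j),
    mul_le_of_le_one_right this (M.abscissae_le_one j)⟩

theorem time_mem {a : ι} {h : ℝ} (hh : h ∈ Set.Icc 0 (𝔉.H a)) :
    𝔉.t₀ + h ∈ Set.Icc 𝔉.t₀ (𝔉.t₀ + 𝔉.δ) :=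
  ⟨by linarith [hh.1], by linarith [hh.2, 𝔉.le_δ a]⟩

theorem v_mem (a : ι) (i : Fin s) {τ : ℝ} (hτ : τ ∈ Set.Icc (0 : ℝ) 1) :
    𝔉.v a i τ ∈ Metric.closedBall (𝔉.y 𝔉.t₀) (𝔉.r + 1) := by
  have h1 := 𝔉.bound.norm_isStage_sub_le (𝔉.pos a) (𝔉.le_δ a) (𝔉.speed_le a) (𝔉.mem a)
    (𝔉.stage a i) hτ
  have h2 := 𝔉.mem a i.castSucc
  rw [mem_closedBall_iff_norm] at h2 ⊢
  calc ‖𝔉.v a i τ - 𝔉.y 𝔉.t₀‖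
      = ‖(𝔉.v a i τ - 𝔉.Y a i.castSucc) + (𝔉.Y a i.castSucc - 𝔉.y 𝔉.t₀)‖ := by congr 1; abel
    _ ≤ ‖𝔉.v a i τ - 𝔉.Y a i.castSucc‖ + ‖𝔉.Y a i.castSucc - 𝔉.y 𝔉.t₀‖ := norm_add_le _ _
    _ ≤ 𝔉.r + 1 := by linarith [𝔉.speed_le a]

theorem Y_mem (a : ι) (j : Fin (s + 1)) :
    𝔉.Y a j ∈ Metric.closedBall (𝔉.y 𝔉.t₀) (𝔉.r + 1) :=
  Metric.closedBall_subset_closedBall (by linarith) (𝔉.mem a j)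

theorem hasDerivWithinAt_elapsed (a : ι) (i : Fin s) (τ : ℝ) :
    HasDerivWithinAt (fun τ => 𝔉.t₀ + 𝔉.elapsed a i τ) (𝔉.H a * M.base.deltaC i)
      (Set.Icc 0 1) τ := by
  unfold elapsed
  simpa using ((((hasDerivWithinAt_id τ (Set.Icc (0 : ℝ) 1)).const_mul
    (M.base.deltaC i)).const_add (M.base.c i)).const_mul (𝔉.H a)).const_add 𝔉.t₀

theorem hasDerivWithinAt_err (a : ι) (i : Fin s) {τ : ℝ} (hτ : τ ∈ Set.Icc (0 : ℝ) 1) :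
    HasDerivWithinAt (𝔉.err a i) (𝔉.H a • (M.base.deltaC i • 𝔉.fastDefect a i τ +
      ∑ j, M.gamma i j τ • 𝔉.slowDefect a j + 𝔉.tendency 𝔉.φ a i τ)) (Set.Icc 0 1) τ := by
  have hmaps : Set.MapsTo (fun τ => 𝔉.t₀ + 𝔉.elapsed a i τ) (Set.Icc 0 1)
      (Set.Icc 𝔉.t₀ (𝔉.t₀ + 𝔉.δ)) := fun σ hσ => 𝔉.time_mem (𝔉.elapsed_mem a i hσ)
  have hy := (𝔉.isExact _ (hmaps hτ)).scomp τ (𝔉.hasDerivWithinAt_elapsed a i τ) hmaps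
  refine (((𝔉.stage a i).deriv τ hτ).sub hy).congr_deriv ?_
  simp only [stageField, fastDefect, slowDefect, tendency, φ, smul_sub, Finset.sum_sub_distrib,
    elapsed]
  module

theorem err_zero (a : ι) (i : Fin s) : 𝔉.err a i 0 = 𝔉.nodeErr a i.castSucc := by
  simp [err, nodeErr, elapsed, (𝔉.stage a i).init]

theorem err_one (a : ι) (i : Fin s) : 𝔉.err a i 1 = 𝔉.nodeErr a i.succ := by
  simp [err, nodeErr, elapsed, (𝔉.stage a i).final, RKMethod.node_succ]

theorem nodeErr_zero (a : ι) : 𝔉.nodeErr a 0 = 0 := by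
  simp [nodeErr, 𝔉.start, 𝔉.node_zero]

theorem isBigO_pow {k l : ℕ} (hkl : k ≤ l) :
    (fun p : ι × ℝ => 𝔉.H p.1 ^ l) =O[unitTime ι] fun p => 𝔉.H p.1 ^ k :=
  isBigO_unitTime_of_le (f := fun a _ => 𝔉.H a ^ l) (g := fun a => 𝔉.H a ^ k) 1 fun a _ _ => by
    have := (𝔉.pos a).le
    rw [one_mul, Real.norm_of_nonneg (pow_nonneg this _), Real.norm_of_nonneg (pow_nonneg this _)]
    exact pow_le_pow_of_le_one this (𝔉.le_one a) hkl

theorem isBigO_gamma_smul (i j : Fin s) {E : Type*} [NormedAddCommGroup E] [NormedSpace ℝ E]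
    {f : ι × ℝ → E} {k : ℕ} (hf : f =O[unitTime ι] fun p => 𝔉.H p.1 ^ k) :
    (fun p : ι × ℝ => M.gamma i j p.2 • f p) =O[unitTime ι] fun p => 𝔉.H p.1 ^ k := by
  simpa using (isBigO_unitTime_one (M.continuous_gamma i j)).smul hf

theorem isBigO_H_smul {E : Type*} [NormedAddCommGroup E] [NormedSpace ℝ E]
    {f : ι × ℝ → E} {k : ℕ} (hf : f =O[unitTime ι] fun p => 𝔉.H p.1 ^ k) :
    (fun p : ι × ℝ => 𝔉.H p.1 • f p) =O[unitTime ι] fun p => 𝔉.H p.1 ^ (k + 1) := by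
  simpa only [pow_succ', smul_eq_mul] using
    (isBigO_refl (fun p : ι × ℝ => 𝔉.H p.1) (unitTime ι)).smul hf

theorem isBigO_tendency {R : ℝ → EuclideanSpace ℝ (Fin d)} {C : ℝ} {k : ℕ} (hC : 0 ≤ C)
    (hR : ∀ h ∈ Set.Icc 0 𝔉.δ, h ≤ 1 → ‖R h‖ ≤ C * h ^ k) (i : Fin s) :
    (fun p : ι × ℝ => 𝔉.tendency R p.1 i p.2) =O[unitTime ι] fun p => 𝔉.H p.1 ^ k := by
  have hb : ∀ a, ∀ h ∈ Set.Icc 0 (𝔉.H a), ‖R h‖ ≤ C * ‖𝔉.H a ^ k‖ := fun a h hh => by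
    rw [Real.norm_of_nonneg (pow_nonneg (𝔉.pos a).le _)]
    exact (hR h ⟨hh.1, hh.2.trans (𝔉.le_δ a)⟩ (hh.2.trans (𝔉.le_one a))).trans
      (mul_le_mul_of_nonneg_left (pow_le_pow_left₀ hh.1 hh.2 k) hC)
  have h1 : ∀ j, (fun p : ι × ℝ => R (𝔉.H p.1 * M.base.c j)) =O[unitTime ι]
      fun p => 𝔉.H p.1 ^ k := fun j =>
    isBigO_unitTime_of_le (f := fun a _ => R (𝔉.H a * M.base.c j)) (g := fun a => 𝔉.H a ^ k) C
      fun a _ _ => hb a _ (𝔉.slow_time_mem a j)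
  have h2 : (fun p : ι × ℝ => R (𝔉.elapsed p.1 i p.2)) =O[unitTime ι] fun p => 𝔉.H p.1 ^ k :=
    isBigO_unitTime_of_le (f := fun a τ => R (𝔉.elapsed a i τ)) (g := fun a => 𝔉.H a ^ k) C
      fun a τ hτ => hb a _ (𝔉.elapsed_mem a i hτ)
  exact (IsBigO.fun_sum fun j _ => 𝔉.isBigO_gamma_smul i j (h1 j)).sub
    (h2.const_smul_left (M.base.deltaC i))

theorem tendency_add (R S : ℝ → EuclideanSpace ℝ (Fin d)) (a : ι) (i : Fin s) (τ : ℝ) :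
    𝔉.tendency (fun h => R h + S h) a i τ = 𝔉.tendency R a i τ + 𝔉.tendency S a i τ := by
  simp only [tendency, smul_add, Finset.sum_add_distrib]
  abel

theorem tendency_const (u : EuclideanSpace ℝ (Fin d)) (a : ι) (i : Fin s) (τ : ℝ) :
    𝔉.tendency (fun _ => u) a i τ = 0 := by
  rw [tendency, ← Finset.sum_smul, 𝔉.bound.consistent.sum_gamma, sub_self]

/-- The tendency of the monomial `h ^ k`, up to the factor `H ^ k`. -/
def kappa (M : MRIGARK s m) (k : ℕ) (i : Fin s) (τ : ℝ) : ℝ :=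
  ∑ j, M.gamma i j τ * M.base.c j ^ k -
    M.base.deltaC i * (M.base.c i + M.base.deltaC i * τ) ^ k

theorem tendency_pow (u : EuclideanSpace ℝ (Fin d)) (k : ℕ) (a : ι) (i : Fin s) (τ : ℝ) :
    𝔉.tendency (fun h => h ^ k • u) a i τ = (𝔉.H a ^ k * kappa M k i τ) • u := by
  simp only [tendency, kappa, elapsed, smul_smul, ← Finset.sum_smul, ← sub_smul]
  congr 1
  rw [mul_sub, Finset.mul_sum]
  congr 1
  · exact Finset.sum_congr rfl fun j _ => by ring
  · rw [mul_pow]; ring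

theorem continuous_kappa (k : ℕ) (i : Fin s) : Continuous (kappa M k i) := by
  have h := M.continuous_gamma i
  unfold kappa
  fun_prop

/-- The defect of the quadrature that stage `i` applies to the slow field. -/
theorem isBigO_tendency_φ (i : Fin s) :
    (fun p : ι × ℝ => 𝔉.tendency 𝔉.φ p.1 i p.2 - (𝔉.H p.1 ^ 1 * kappa M 1 i p.2) • 𝔉.φ₁ -
      (𝔉.H p.1 ^ 2 * kappa M 2 i p.2) • 𝔉.φ₂) =O[unitTime ι] fun p => 𝔉.H p.1 ^ 3 := by
  set R : ℝ → EuclideanSpace ℝ (Fin d) := fun h => 𝔉.φ h - 𝔉.φ₀ - h • 𝔉.φ₁ - h ^ 2 • 𝔉.φ₂ with hR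
  have h1 := 𝔉.isBigO_tendency (R := R) (abs_nonneg 𝔉.Kφ) (k := 3) (fun h hh _ =>
    (𝔉.φ_le h hh).trans (mul_le_mul_of_nonneg_right (le_abs_self _) (pow_nonneg hh.1 3))) i
  refine h1.congr_left fun p => ?_
  have hφ : 𝔉.φ = fun h => ((R h + h ^ 2 • 𝔉.φ₂) + h ^ 1 • 𝔉.φ₁) + 𝔉.φ₀ := by
    funext h
    simp only [hR]
    module
  rw [hφ, tendency_add, tendency_add, tendency_add, tendency_const, tendency_pow, tendency_pow]
  abel

theorem isBigO_v_sub (i : Fin s) :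
    (fun p : ι × ℝ => 𝔉.v p.1 i p.2 - 𝔉.y 𝔉.t₀) =O[unitTime ι] fun p => 𝔉.H p.1 ^ 1 := by
  refine (isBigO_unitTime_stages (X := fun a j => 𝔉.Y a j - 𝔉.y 𝔉.t₀)
    (w := fun a i τ => 𝔉.v a i τ - 𝔉.y 𝔉.t₀)
    (w' := fun a i τ => M.stageField fF fS 𝔉.t₀ (𝔉.H a) (𝔉.Y a) i τ (𝔉.v a i τ))
    (g := fun a => 𝔉.H a ^ 1)
    (fun a i => by rw [(𝔉.stage a i).init]) (fun a i => by rw [(𝔉.stage a i).final])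
    (fun a i τ hτ => ((𝔉.stage a i).deriv τ hτ).sub_const _) (fun a => by rw [𝔉.start, sub_self])
    fun i => ?_).2 i
  refine isBigO_unitTime_of_le
    (f := fun a τ => M.stageField fF fS 𝔉.t₀ (𝔉.H a) (𝔉.Y a) i τ (𝔉.v a i τ))
    (g := fun a => 𝔉.H a ^ 1) (speed 𝔉.K 𝔉.N) fun a τ hτ => ?_
  rw [pow_one, Real.norm_of_nonneg (𝔉.pos a).le, mul_comm]
  exact (𝔉.bound.norm_stageField_lt (𝔉.pos a) (𝔉.le_δ a) (𝔉.Y_mem a) i hτ (𝔉.v_mem a i hτ)).le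

theorem isBigO_y_sub {σ : ι → ℝ → ℝ}
    (hσ : ∀ a, ∀ τ ∈ Set.Icc (0 : ℝ) 1, σ a τ ∈ Set.Icc 0 (𝔉.H a)) :
    (fun p : ι × ℝ => 𝔉.y (𝔉.t₀ + σ p.1 p.2) - 𝔉.y 𝔉.t₀) =O[unitTime ι]
      fun p => 𝔉.H p.1 ^ 1 := by
  refine isBigO_unitTime_of_le (f := fun a τ => 𝔉.y (𝔉.t₀ + σ a τ) - 𝔉.y 𝔉.t₀)
    (g := fun a => 𝔉.H a ^ 1) |𝔉.Ky| fun a τ hτ => ?_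
  obtain ⟨h0, h1⟩ := hσ a τ hτ
  rw [pow_one, Real.norm_of_nonneg (𝔉.pos a).le]
  exact (𝔉.y_le _ ⟨h0, h1.trans (𝔉.le_δ a)⟩).trans
    (mul_le_mul (le_abs_self _) h1 h0 (abs_nonneg _))

theorem isBigO_Y_sub (j : Fin s) :
    (fun p : ι × ℝ => 𝔉.Y p.1 j.castSucc - 𝔉.y 𝔉.t₀) =O[unitTime ι] fun p => 𝔉.H p.1 ^ 1 := by
  have h := isBigO_unitTime_eval (f := fun a τ => 𝔉.v a j τ - 𝔉.y 𝔉.t₀)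
    (g := fun a => 𝔉.H a ^ 1) (Set.left_mem_Icc.2 zero_le_one) (𝔉.isBigO_v_sub j)
  exact h.congr_left fun p => by rw [(𝔉.stage p.1 j).init]

/-- Two curves that stay close to the initial point: the increment of a controlled field between
them is of the order of their distance, and is linear up to a further factor `H`. -/
theorem isBigO_field_sub {f : ℝ → EuclideanSpace ℝ (Fin d) → EuclideanSpace ℝ (Fin d)}
    {A : EuclideanSpace ℝ (Fin d) →L[ℝ] EuclideanSpace ℝ (Fin d)}
    (hf : FieldBound f 𝔉.t₀ 𝔉.δ (𝔉.y 𝔉.t₀) (𝔉.r + 1) 𝔉.K A) {σ : ι → ℝ → ℝ}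
    (hσ : ∀ a, ∀ τ ∈ Set.Icc (0 : ℝ) 1, σ a τ ∈ Set.Icc 0 (𝔉.H a))
    {x : ι → ℝ → EuclideanSpace ℝ (Fin d)}
    (hx : ∀ a, ∀ τ ∈ Set.Icc (0 : ℝ) 1, x a τ ∈ Metric.closedBall (𝔉.y 𝔉.t₀) (𝔉.r + 1))
    (hxO : (fun p : ι × ℝ => x p.1 p.2 - 𝔉.y 𝔉.t₀) =O[unitTime ι] fun p => 𝔉.H p.1 ^ 1) {k : ℕ}
    (he : (fun p : ι × ℝ => x p.1 p.2 - 𝔉.y (𝔉.t₀ + σ p.1 p.2)) =O[unitTime ι]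
      fun p => 𝔉.H p.1 ^ k) :
    ((fun p : ι × ℝ => f (𝔉.t₀ + σ p.1 p.2) (x p.1 p.2) -
      f (𝔉.t₀ + σ p.1 p.2) (𝔉.y (𝔉.t₀ + σ p.1 p.2))) =O[unitTime ι] fun p => 𝔉.H p.1 ^ k) ∧
    (fun p : ι × ℝ => f (𝔉.t₀ + σ p.1 p.2) (x p.1 p.2) -
      f (𝔉.t₀ + σ p.1 p.2) (𝔉.y (𝔉.t₀ + σ p.1 p.2)) -
      A (x p.1 p.2 - 𝔉.y (𝔉.t₀ + σ p.1 p.2))) =O[unitTime ι] fun p => 𝔉.H p.1 ^ (k + 1) := by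
  constructor
  · refine IsBigO.trans (IsBigO.of_bound 𝔉.K (eventually_unitTime.2 fun a τ hτ => ?_)) he
    exact hf.lipschitz _ (𝔉.time_mem (hσ a τ hτ)) _ (hx a τ hτ) _ (𝔉.y_mem a _ (hσ a τ hτ))
  · have h1 : (fun p : ι × ℝ => 𝔉.H p.1 + ‖x p.1 p.2 - 𝔉.y 𝔉.t₀‖ +
        ‖𝔉.y (𝔉.t₀ + σ p.1 p.2) - 𝔉.y 𝔉.t₀‖) =O[unitTime ι] fun p => 𝔉.H p.1 ^ 1 := by
      refine IsBigO.add (IsBigO.add ?_ hxO.norm_left) (𝔉.isBigO_y_sub hσ).norm_left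
      simpa only [pow_one] using isBigO_refl _ _
    have h2 := h1.mul he.norm_left
    refine IsBigO.trans (IsBigO.of_bound 𝔉.K (eventually_unitTime.2 fun a τ hτ => ?_))
      (h2.congr_right fun p => by rw [← pow_add, add_comm])
    refine (hf.linear _ (𝔉.time_mem (hσ a τ hτ)) _ (hx a τ hτ) _
      (𝔉.y_mem a _ (hσ a τ hτ))).trans ?_
    have hH := (𝔉.pos a).le
    rw [mul_assoc, Real.norm_of_nonneg (by positivity)]
    refine mul_le_mul_of_nonneg_left (mul_le_mul_of_nonneg_right ?_ (norm_nonneg _)) hf.nonneg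
    linarith [(hσ a τ hτ).2]

theorem isBigO_fastDefect {i : Fin s} {k : ℕ}
    (he : (fun p : ι × ℝ => 𝔉.err p.1 i p.2) =O[unitTime ι] fun p => 𝔉.H p.1 ^ k) :
    ((fun p : ι × ℝ => 𝔉.fastDefect p.1 i p.2) =O[unitTime ι] fun p => 𝔉.H p.1 ^ k) ∧
    (fun p : ι × ℝ => 𝔉.fastDefect p.1 i p.2 - 𝔉.AF (𝔉.err p.1 i p.2)) =O[unitTime ι]
      fun p => 𝔉.H p.1 ^ (k + 1) :=
  𝔉.isBigO_field_sub 𝔉.bound.fast (σ := fun a => 𝔉.elapsed a i) (fun a _ hτ => 𝔉.elapsed_mem a i hτ)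
    (x := fun a => 𝔉.v a i) (fun a _ hτ => 𝔉.v_mem a i hτ) (𝔉.isBigO_v_sub i) he

theorem isBigO_slowDefect {j : Fin s} {k : ℕ}
    (he : (fun p : ι × ℝ => 𝔉.nodeErr p.1 j.castSucc) =O[unitTime ι] fun p => 𝔉.H p.1 ^ k) :
    ((fun p : ι × ℝ => 𝔉.slowDefect p.1 j) =O[unitTime ι] fun p => 𝔉.H p.1 ^ k) ∧
    (fun p : ι × ℝ => 𝔉.slowDefect p.1 j - 𝔉.AS (𝔉.nodeErr p.1 j.castSucc)) =O[unitTime ι]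
      fun p => 𝔉.H p.1 ^ (k + 1) := by
  simp only [nodeErr, RKMethod.node_castSucc] at he ⊢
  exact 𝔉.isBigO_field_sub 𝔉.bound.slow (σ := fun a _ => 𝔉.H a * M.base.c j)
    (fun a _ _ => 𝔉.slow_time_mem a j) (x := fun a _ => 𝔉.Y a j.castSucc)
    (fun a _ _ => 𝔉.Y_mem a _) (𝔉.isBigO_Y_sub j) he

end StepFamily

end MRIGARK

/-! ### Expansion of the error -/

namespace MRIGARK

open Asymptotics

variable {s m d : ℕ}

theorem A_mulVec_c_apply (M : MRIGARK s m) (i : Fin s) :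
    (M.base.A *ᵥ M.base.c) i =
      ∑ l, if l < i then ∑ j, M.gammaInt l j 1 * M.base.c j else 0 := by
  simp only [Matrix.mulVec, dotProduct, base_A_apply, Finset.sum_mul, ite_mul, zero_mul]
  rw [Finset.sum_comm]
  refine Finset.sum_congr rfl fun l _ => ?_
  split_ifs <;> simp

/-- The coefficient of `H² φ₁` in the error of the stage values. -/
def nodeCoeff (M : MRIGARK s m) (i : Fin (s + 1)) : ℝ :=
  (∑ l : Fin s, if l.castSucc < i then ∑ j, M.gammaInt l j 1 * M.base.c j else 0) -
    M.base.node i ^ 2 / 2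

/-- The coefficient of `H² φ₁` in the error in the course of stage `i`. -/
def stageCoeff (M : MRIGARK s m) (i : Fin s) (τ : ℝ) : ℝ :=
  (M.base.A *ᵥ M.base.c) i + ∑ j, M.gammaInt i j τ * M.base.c j -
    (M.base.c i + M.base.deltaC i * τ) ^ 2 / 2

theorem nodeCoeff_castSucc (M : MRIGARK s m) (i : Fin s) :
    M.nodeCoeff i.castSucc = (M.base.A *ᵥ M.base.c) i - M.base.c i ^ 2 / 2 := by
  simp [nodeCoeff, A_mulVec_c_apply]

theorem stageCoeff_zero (M : MRIGARK s m) (i : Fin s) :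
    M.stageCoeff i 0 = M.nodeCoeff i.castSucc := by
  simp [nodeCoeff_castSucc, stageCoeff]

theorem stageCoeff_one (M : MRIGARK s m) (i : Fin s) :
    M.stageCoeff i 1 = M.nodeCoeff i.succ := by
  rw [nodeCoeff, Fin.sum_filter_castSucc_lt_succ, RKMethod.node_succ, stageCoeff,
    A_mulVec_c_apply]
  simp

theorem hasDerivAt_gammaInt_mul_sum (M : MRIGARK s m) (i : Fin s) (u : Fin s → ℝ) (τ : ℝ) :
    HasDerivAt (fun τ => ∑ j, M.gammaInt i j τ * u j) (∑ j, M.gamma i j τ * u j) τ :=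
  HasDerivAt.fun_sum fun j _ => (M.hasDerivAt_gammaInt i j τ).mul_const _

theorem hasDerivAt_c_add_pow (M : MRIGARK s m) (i : Fin s) (k : ℕ) (τ : ℝ) :
    HasDerivAt (fun τ => (M.base.c i + M.base.deltaC i * τ) ^ (k + 1) / ((k : ℝ) + 1))
      (M.base.deltaC i * (M.base.c i + M.base.deltaC i * τ) ^ k) τ := by
  have h : HasDerivAt (fun τ => M.base.c i + M.base.deltaC i * τ) (M.base.deltaC i) τ := by
    simpa using ((hasDerivAt_id τ).const_mul (M.base.deltaC i)).const_add (M.base.c i)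
  refine ((h.pow (k + 1)).div_const _).congr_deriv ?_
  have : (k : ℝ) + 1 ≠ 0 := by positivity
  simp only [Nat.add_sub_cancel]
  push_cast
  field_simp

/-- An antiderivative of `kappa M k i`. -/
def kappaInt (M : MRIGARK s m) (k : ℕ) (i : Fin s) (τ : ℝ) : ℝ :=
  ∑ j, M.gammaInt i j τ * M.base.c j ^ k -
    (M.base.c i + M.base.deltaC i * τ) ^ (k + 1) / ((k : ℝ) + 1)

theorem hasDerivAt_kappaInt (M : MRIGARK s m) (k : ℕ) (i : Fin s) (τ : ℝ) :
    HasDerivAt (M.kappaInt k i) (StepFamily.kappa M k i τ) τ :=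
  (M.hasDerivAt_gammaInt_mul_sum i _ τ).sub (M.hasDerivAt_c_add_pow i k τ)

theorem hasDerivAt_stageCoeff (M : MRIGARK s m) (i : Fin s) (τ : ℝ) :
    HasDerivAt (M.stageCoeff i) (StepFamily.kappa M 1 i τ) τ := by
  have h := (M.hasDerivAt_kappaInt 1 i τ).const_add ((M.base.A *ᵥ M.base.c) i)
  refine h.congr_of_eventuallyEq (Filter.Eventually.of_forall fun σ => ?_)
  simp only [stageCoeff, kappaInt]
  norm_num
  ring

/-- An antiderivative of `Δcᵢ` times `stageCoeff M i`. -/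
def stageCoeffInt (M : MRIGARK s m) (i : Fin s) (τ : ℝ) : ℝ :=
  M.base.deltaC i * ((M.base.A *ᵥ M.base.c) i * τ + ∑ j, M.gammaIntInt i j τ * M.base.c j) -
    (M.base.c i + M.base.deltaC i * τ) ^ 3 / 6

theorem hasDerivAt_stageCoeffInt (M : MRIGARK s m) (i : Fin s) (τ : ℝ) :
    HasDerivAt (M.stageCoeffInt i) (M.base.deltaC i * M.stageCoeff i τ) τ := by
  have h1 : HasDerivAt (fun τ => ∑ j, M.gammaIntInt i j τ * M.base.c j)
      (∑ j, M.gammaInt i j τ * M.base.c j) τ :=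
    HasDerivAt.fun_sum fun j _ => (M.hasDerivAt_gammaIntInt i j τ).mul_const _
  have h2 : HasDerivAt (fun τ => (M.base.A *ᵥ M.base.c) i * τ) ((M.base.A *ᵥ M.base.c) i) τ := by
    simpa using (hasDerivAt_id τ).const_mul ((M.base.A *ᵥ M.base.c) i)
  have h := ((h2.add h1).const_mul (M.base.deltaC i)).sub
    ((M.hasDerivAt_c_add_pow i 2 τ).div_const 2)
  refine (h.congr_of_eventuallyEq (Filter.Eventually.of_forall fun σ => ?_)).congr_deriv ?_
  · simp only [stageCoeffInt, Pi.sub_apply, Pi.add_apply]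
    norm_num
    ring
  · simp only [stageCoeff]
    ring

theorem sum_kappaInt_sub (M : MRIGARK s m) (h0 : M.base.node 0 = 0) (k : ℕ) :
    ∑ i, (M.kappaInt k i 1 - M.kappaInt k i 0) =
      ∑ j, M.base.b j * M.base.c j ^ k - 1 / ((k : ℝ) + 1) := by
  have h := Fin.sum_succ_sub_castSucc fun i => M.base.node i ^ (k + 1) / ((k : ℝ) + 1)
  simp only [RKMethod.node_last, h0, RKMethod.node_succ, RKMethod.node_castSucc, one_pow] at h
  have h1 : ∀ i, M.kappaInt k i 1 - M.kappaInt k i 0 = ∑ j, M.gammaInt i j 1 * M.base.c j ^ k -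
      ((M.base.c i + M.base.deltaC i) ^ (k + 1) / ((k : ℝ) + 1) -
        M.base.c i ^ (k + 1) / ((k : ℝ) + 1)) := fun i => by
    simp [kappaInt]
    ring
  simp only [h1]
  rw [Finset.sum_sub_distrib, h, Finset.sum_comm]
  simp [base_b_apply, Finset.sum_mul]

theorem sum_stageCoeffInt_sub (M : MRIGARK s m) (h0 : M.base.node 0 = 0) :
    ∑ i, (M.stageCoeffInt i 1 - M.stageCoeffInt i 0) =
      M.base.deltaC ⬝ᵥ (M.frakA *ᵥ M.base.c) - 1 / 6 := by
  have h := Fin.sum_succ_sub_castSucc fun i => M.base.node i ^ 3 / 6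
  simp only [RKMethod.node_last, h0, RKMethod.node_succ, RKMethod.node_castSucc, one_pow] at h
  have h1 : ∀ i, M.stageCoeffInt i 1 - M.stageCoeffInt i 0 =
      M.base.deltaC i * (M.frakA *ᵥ M.base.c) i -
      ((M.base.c i + M.base.deltaC i) ^ 3 / 6 - M.base.c i ^ 3 / 6) := fun i => by
    have h2 : (M.frakA *ᵥ M.base.c) i =
        (M.base.A *ᵥ M.base.c) i + ∑ j, M.gammaIntInt i j 1 * M.base.c j := by
      simp [Matrix.mulVec, dotProduct, frakA_apply, add_mul, Finset.sum_add_distrib]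
    rw [h2]
    simp [stageCoeffInt]
    ring
  simp only [h1]
  rw [Finset.sum_sub_distrib, h]
  simp [dotProduct]

namespace StepFamily

variable {M : MRIGARK s m} {fF fS : ℝ → EuclideanSpace ℝ (Fin d) → EuclideanSpace ℝ (Fin d)}
  {ι : Type*} (𝔉 : StepFamily M fF fS ι)

theorem isBigO_kappa_smul (k : ℕ) (i : Fin s) (u : EuclideanSpace ℝ (Fin d)) :
    (fun p : ι × ℝ => (𝔉.H p.1 ^ k * kappa M k i p.2) • u) =O[unitTime ι]
      fun p => 𝔉.H p.1 ^ k := by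
  have h := ((isBigO_refl (fun p : ι × ℝ => 𝔉.H p.1 ^ k) (unitTime ι)).mul
    (isBigO_unitTime_one (continuous_kappa (M := M) k i))).smul
    (isBigO_const_const u (one_ne_zero (α := ℝ)) (unitTime ι))
  simpa using h

theorem isBigO_tendency_φ_two (i : Fin s) :
    (fun p : ι × ℝ => 𝔉.tendency 𝔉.φ p.1 i p.2 - (𝔉.H p.1 ^ 1 * kappa M 1 i p.2) • 𝔉.φ₁)
      =O[unitTime ι] fun p => 𝔉.H p.1 ^ 2 := by
  refine (((𝔉.isBigO_tendency_φ i).trans (𝔉.isBigO_pow (by norm_num))).add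
    (𝔉.isBigO_kappa_smul 2 i 𝔉.φ₂)).congr_left fun p => ?_
  abel

theorem isBigO_tendency_φ_one (i : Fin s) :
    (fun p : ι × ℝ => 𝔉.tendency 𝔉.φ p.1 i p.2) =O[unitTime ι] fun p => 𝔉.H p.1 ^ 1 := by
  refine (((𝔉.isBigO_tendency_φ_two i).trans (𝔉.isBigO_pow (by norm_num))).add
    (𝔉.isBigO_kappa_smul 1 i 𝔉.φ₁)).congr_left fun p => ?_
  abel

/-- The derivative of the error combines a fast, a slow and a quadrature defect, and gains one power
of `H` over them. -/
theorem isBigO_combination {k : ℕ} {i : Fin s} {F T : ι × ℝ → EuclideanSpace ℝ (Fin d)}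
    {S : Fin s → ι × ℝ → EuclideanSpace ℝ (Fin d)}
    (hF : F =O[unitTime ι] fun p => 𝔉.H p.1 ^ k)
    (hS : ∀ j, S j =O[unitTime ι] fun p => 𝔉.H p.1 ^ k)
    (hT : T =O[unitTime ι] fun p => 𝔉.H p.1 ^ k) :
    (fun p : ι × ℝ => 𝔉.H p.1 • (M.base.deltaC i • F p + ∑ j, M.gamma i j p.2 • S j p + T p))
      =O[unitTime ι] fun p => 𝔉.H p.1 ^ (k + 1) :=
  𝔉.isBigO_H_smul (((hF.const_smul_left (M.base.deltaC i)).add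
    (IsBigO.fun_sum fun j _ => 𝔉.isBigO_gamma_smul i j (hS j))).add hT)

/-- All errors are of second order. -/
theorem isBigO_err_two :
    (∀ j, (fun p : ι × ℝ => 𝔉.nodeErr p.1 j) =O[unitTime ι] fun p => 𝔉.H p.1 ^ 2) ∧
      ∀ i, (fun p : ι × ℝ => 𝔉.err p.1 i p.2) =O[unitTime ι] fun p => 𝔉.H p.1 ^ 2 := by
  have h1 : ∀ i, (fun p : ι × ℝ => 𝔉.err p.1 i p.2) =O[unitTime ι] fun p => 𝔉.H p.1 ^ 1 := by
    intro i
    refine ((𝔉.isBigO_v_sub i).sub (𝔉.isBigO_y_sub (σ := fun a => 𝔉.elapsed a i)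
      fun a _ hτ => 𝔉.elapsed_mem a i hτ)).congr_left fun p => ?_
    simp only [err]
    abel
  have h2 : ∀ j : Fin s, (fun p : ι × ℝ => 𝔉.nodeErr p.1 j.castSucc) =O[unitTime ι]
      fun p => 𝔉.H p.1 ^ 1 := fun j =>
    (isBigO_unitTime_eval (f := fun a τ => 𝔉.err a j τ) (g := fun a => 𝔉.H a ^ 1)
      (Set.left_mem_Icc.2 zero_le_one) (h1 j)).congr_left fun p => 𝔉.err_zero p.1 j
  exact isBigO_unitTime_stages (g := fun a => 𝔉.H a ^ 2) 𝔉.err_zero 𝔉.err_one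
    (fun a i τ hτ => 𝔉.hasDerivWithinAt_err a i hτ) 𝔉.nodeErr_zero fun i =>
      𝔉.isBigO_combination (𝔉.isBigO_fastDefect (h1 i)).1
        (fun j => (𝔉.isBigO_slowDefect (h2 j)).1) (𝔉.isBigO_tendency_φ_one i)

/-- The errors to second order. The multiples of `φ₁` are the only contribution, because the defects
of the fields are themselves of second order. -/
theorem isBigO_err_three :
    (∀ j, (fun p : ι × ℝ => 𝔉.nodeErr p.1 j - (𝔉.H p.1 ^ 2 * M.nodeCoeff j) • 𝔉.φ₁)
        =O[unitTime ι] fun p => 𝔉.H p.1 ^ 3) ∧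
      ∀ i, (fun p : ι × ℝ => 𝔉.err p.1 i p.2 - (𝔉.H p.1 ^ 2 * M.stageCoeff i p.2) • 𝔉.φ₁)
        =O[unitTime ι] fun p => 𝔉.H p.1 ^ 3 := by
  obtain ⟨h1, h2⟩ := 𝔉.isBigO_err_two
  refine isBigO_unitTime_stages (g := fun a => 𝔉.H a ^ 3)
    (X := fun a j => 𝔉.nodeErr a j - (𝔉.H a ^ 2 * M.nodeCoeff j) • 𝔉.φ₁)
    (w := fun a i τ => 𝔉.err a i τ - (𝔉.H a ^ 2 * M.stageCoeff i τ) • 𝔉.φ₁)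
    (w' := fun a i τ => 𝔉.H a • (M.base.deltaC i • 𝔉.fastDefect a i τ +
      ∑ j, M.gamma i j τ • 𝔉.slowDefect a j +
      (𝔉.tendency 𝔉.φ a i τ - (𝔉.H a ^ 1 * kappa M 1 i τ) • 𝔉.φ₁)))
    (fun a i => by rw [𝔉.err_zero, stageCoeff_zero]) (fun a i => by rw [𝔉.err_one, stageCoeff_one])
    (fun a i τ hτ => ?_) (fun a => ?_) fun i =>
      𝔉.isBigO_combination (𝔉.isBigO_fastDefect (h2 i)).1
        (fun j => (𝔉.isBigO_slowDefect (h1 j.castSucc)).1) (𝔉.isBigO_tendency_φ_two i)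
  · refine ((𝔉.hasDerivWithinAt_err a i hτ).sub (((M.hasDerivAt_stageCoeff i τ).const_mul
      (𝔉.H a ^ 2)).smul_const 𝔉.φ₁).hasDerivWithinAt).congr_deriv ?_
    module
  · simp [𝔉.nodeErr_zero, nodeCoeff, 𝔉.node_zero]

/-- The expansion of the error in the course of stage `i` up to fourth order, apart from its
initial value. -/
def errExpansion (a : ι) (i : Fin s) (τ : ℝ) : EuclideanSpace ℝ (Fin d) :=
  (𝔉.H a ^ 3 * M.stageCoeffInt i τ) • 𝔉.AF 𝔉.φ₁ +
    (𝔉.H a ^ 3 * ∑ j, M.gammaInt i j τ * M.nodeCoeff j.castSucc) • 𝔉.AS 𝔉.φ₁ +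
    (𝔉.H a ^ 2 * M.kappaInt 1 i τ) • 𝔉.φ₁ + (𝔉.H a ^ 3 * M.kappaInt 2 i τ) • 𝔉.φ₂

theorem isBigO_err_four (i : Fin s) :
    (fun p : ι × ℝ => (𝔉.err p.1 i p.2 - 𝔉.errExpansion p.1 i p.2) -
      (𝔉.err p.1 i 0 - 𝔉.errExpansion p.1 i 0)) =O[unitTime ι] fun p => 𝔉.H p.1 ^ 4 := by
  obtain ⟨h1, h2⟩ := 𝔉.isBigO_err_two
  obtain ⟨h3, h4⟩ := 𝔉.isBigO_err_three
  have hF : (fun p : ι × ℝ => 𝔉.fastDefect p.1 i p.2 -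
      𝔉.AF ((𝔉.H p.1 ^ 2 * M.stageCoeff i p.2) • 𝔉.φ₁)) =O[unitTime ι] fun p => 𝔉.H p.1 ^ 3 := by
    refine ((𝔉.isBigO_fastDefect (h2 i)).2.add
      ((𝔉.AF.isBigO_comp _ _).trans (h4 i))).congr_left fun p => ?_
    rw [map_sub]
    abel
  have hS : ∀ j : Fin s, (fun p : ι × ℝ => 𝔉.slowDefect p.1 j -
      𝔉.AS ((𝔉.H p.1 ^ 2 * M.nodeCoeff j.castSucc) • 𝔉.φ₁)) =O[unitTime ι]
        fun p => 𝔉.H p.1 ^ 3 := fun j => by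
    refine ((𝔉.isBigO_slowDefect (h1 j.castSucc)).2.add
      ((𝔉.AS.isBigO_comp _ _).trans (h3 j.castSucc))).congr_left fun p => ?_
    rw [map_sub]
    abel
  refine isBigO_unitTime_sub_of_deriv (g := fun a => 𝔉.H a ^ 4)
    (w := fun a τ => 𝔉.err a i τ - 𝔉.errExpansion a i τ)
    (w' := fun a τ => 𝔉.H a • (M.base.deltaC i • (𝔉.fastDefect a i τ -
        𝔉.AF ((𝔉.H a ^ 2 * M.stageCoeff i τ) • 𝔉.φ₁)) +
      ∑ j, M.gamma i j τ • (𝔉.slowDefect a j -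
        𝔉.AS ((𝔉.H a ^ 2 * M.nodeCoeff j.castSucc) • 𝔉.φ₁)) +
      (𝔉.tendency 𝔉.φ a i τ - (𝔉.H a ^ 1 * kappa M 1 i τ) • 𝔉.φ₁ -
        (𝔉.H a ^ 2 * kappa M 2 i τ) • 𝔉.φ₂))) (fun a τ hτ => ?_)
    (𝔉.isBigO_combination (i := i) hF hS (𝔉.isBigO_tendency_φ i))
  have hd := (((((M.hasDerivAt_stageCoeffInt i τ).const_mul (𝔉.H a ^ 3)).smul_const
      (𝔉.AF 𝔉.φ₁)).add (((M.hasDerivAt_gammaInt_mul_sum i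
        (fun j => M.nodeCoeff j.castSucc) τ).const_mul (𝔉.H a ^ 3)).smul_const (𝔉.AS 𝔉.φ₁))).add
      (((M.hasDerivAt_kappaInt 1 i τ).const_mul (𝔉.H a ^ 2)).smul_const 𝔉.φ₁)).add
      (((M.hasDerivAt_kappaInt 2 i τ).const_mul (𝔉.H a ^ 3)).smul_const 𝔉.φ₂)
  refine ((𝔉.hasDerivWithinAt_err a i hτ).sub hd.hasDerivWithinAt).congr_deriv ?_
  have hsum : ∑ j, M.gamma i j τ • 𝔉.AS ((𝔉.H a ^ 2 * M.nodeCoeff j.castSucc) • 𝔉.φ₁) =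
      (𝔉.H a ^ 2 * ∑ j, M.gamma i j τ * M.nodeCoeff j.castSucc) • 𝔉.AS 𝔉.φ₁ := by
    rw [Finset.mul_sum, Finset.sum_smul]
    refine Finset.sum_congr rfl fun j _ => ?_
    rw [map_smul, smul_smul]
    congr 1
    ring
  simp only [smul_sub, Finset.sum_sub_distrib, hsum]
  simp only [map_smul]
  module

/-- The local error to leading order: if the slow base scheme satisfies the third order
conditions, only the coupling of the slow into the fast dynamics remains. -/
theorem isBigO_error (hb : ∑ j, M.base.b j * M.base.c j ^ 1 = 1 / 2)
    (hb2 : ∑ j, M.base.b j * M.base.c j ^ 2 = 1 / 3)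
    (hbA : ∑ j, M.base.b j * (M.base.A *ᵥ M.base.c) j = 1 / 6) :
    (fun p : ι × ℝ => 𝔉.Y p.1 (Fin.last s) - 𝔉.y (𝔉.t₀ + 𝔉.H p.1) -
      (𝔉.H p.1 ^ 3 * (M.base.deltaC ⬝ᵥ (M.frakA *ᵥ M.base.c) - 1 / 6)) • 𝔉.AF 𝔉.φ₁)
      =O[unitTime ι] fun p => 𝔉.H p.1 ^ 4 := by
  have h := IsBigO.fun_sum (s := Finset.univ) fun i _ =>
    isBigO_unitTime_eval (f := fun a τ => (𝔉.err a i τ - 𝔉.errExpansion a i τ) -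
      (𝔉.err a i 0 - 𝔉.errExpansion a i 0)) (g := fun a => 𝔉.H a ^ 4)
      (Set.right_mem_Icc.2 zero_le_one) (𝔉.isBigO_err_four i)
  refine h.congr_left fun p => ?_
  have hdiff : ∀ i, (𝔉.err p.1 i 1 - 𝔉.errExpansion p.1 i 1) -
      (𝔉.err p.1 i 0 - 𝔉.errExpansion p.1 i 0) =
      (𝔉.nodeErr p.1 i.succ - 𝔉.nodeErr p.1 i.castSucc) -
      ((𝔉.H p.1 ^ 3 * (M.stageCoeffInt i 1 - M.stageCoeffInt i 0)) • 𝔉.AF 𝔉.φ₁ +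
      (𝔉.H p.1 ^ 3 * ∑ j, M.gammaInt i j 1 * M.nodeCoeff j.castSucc) • 𝔉.AS 𝔉.φ₁ +
      (𝔉.H p.1 ^ 2 * (M.kappaInt 1 i 1 - M.kappaInt 1 i 0)) • 𝔉.φ₁ +
      (𝔉.H p.1 ^ 3 * (M.kappaInt 2 i 1 - M.kappaInt 2 i 0)) • 𝔉.φ₂) := by
    intro i
    rw [𝔉.err_zero, 𝔉.err_one]
    simp only [errExpansion, gammaInt_zero, zero_mul, Finset.sum_const_zero, mul_zero, zero_smul]
    module
  have hq : ∑ i, ∑ j, M.gammaInt i j 1 * M.nodeCoeff j.castSucc = 0 := by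
    rw [Finset.sum_comm]
    simp only [← Finset.sum_mul, ← base_b_apply]
    simp only [nodeCoeff_castSucc, mul_sub, mul_div_assoc']
    rw [Finset.sum_sub_distrib, hbA, ← Finset.sum_div, hb2]
    norm_num
  simp only [hdiff]
  rw [Finset.sum_sub_distrib, Fin.sum_succ_sub_castSucc]
  simp only [Finset.sum_add_distrib, ← Finset.sum_smul, ← Finset.mul_sum, hq,
    M.sum_stageCoeffInt_sub 𝔉.node_zero, M.sum_kappaInt_sub 𝔉.node_zero, hb, hb2]
  rw [𝔉.nodeErr_zero]
  norm_num [nodeErr]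

end StepFamily

end MRIGARK

/-! ### Local error and order three -/

theorem exists_norm_sub_le_of_quadratic {E : Type*} [NormedAddCommGroup E] [NormedSpace ℝ E]
    {f : ℝ → E} {u a b : E} {K δ : ℝ}
    (h : ∀ t ∈ Set.Icc 0 δ, ‖f t - u - t • a - t ^ 2 • b‖ ≤ K * t ^ 3) :
    ∃ K', 0 ≤ K' ∧ ∀ t ∈ Set.Icc 0 δ, ‖f t - u‖ ≤ K' * t := by
  refine ⟨|K| * δ ^ 2 + ‖a‖ + |δ| * ‖b‖, by positivity, fun t ht => ?_⟩
  have ht0 := ht.1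
  have h1 : K * t ^ 3 ≤ |K| * δ ^ 2 * t := by
    calc K * t ^ 3 ≤ |K| * t ^ 3 := mul_le_mul_of_nonneg_right (le_abs_self K) (by positivity)
      _ = |K| * t ^ 2 * t := by ring
      _ ≤ |K| * δ ^ 2 * t := by gcongr; exact ht.2
  have h2 : ‖t ^ 2 • b‖ ≤ |δ| * ‖b‖ * t := by
    rw [norm_smul, Real.norm_of_nonneg (by positivity)]
    calc t ^ 2 * ‖b‖ = t * ‖b‖ * t := by ring
      _ ≤ |δ| * ‖b‖ * t := by gcongr; exact ht.2.trans (le_abs_self δ)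
  have h3 : ‖t • a‖ = ‖a‖ * t := by rw [norm_smul, Real.norm_of_nonneg ht0, mul_comm]
  calc ‖f t - u‖ = ‖(f t - u - t • a - t ^ 2 • b) + t • a + t ^ 2 • b‖ := by congr 1; abel
    _ ≤ ‖f t - u - t • a - t ^ 2 • b‖ + ‖t • a‖ + ‖t ^ 2 • b‖ := norm_add₃_le
    _ ≤ (|K| * δ ^ 2 + ‖a‖ + |δ| * ‖b‖) * t := by linarith [h t ht]

namespace MRIGARK

variable {s m d : ℕ}

/-- For small step sizes a step near the initial value exists, and the local error of all such
steps is given by the coupling of the slow into the fast dynamics, up to `O(H ^ 4)`. -/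
theorem exists_local_error_expansion {M : MRIGARK s m} (hM : M.InternallyConsistent)
    (hn : M.base.node 0 = 0) (hb : ∑ j, M.base.b j * M.base.c j ^ 1 = 1 / 2)
    (hb2 : ∑ j, M.base.b j * M.base.c j ^ 2 = 1 / 3)
    (hbA : ∑ j, M.base.b j * (M.base.A *ᵥ M.base.c) j = 1 / 6)
    {fF fS : ℝ → EuclideanSpace ℝ (Fin d) → EuclideanSpace ℝ (Fin d)}
    (hF : IsSmoothField fF) (hS : IsSmoothField fS) {t₀ δ r Kφ : ℝ}
    {y : ℝ → EuclideanSpace ℝ (Fin d)} (hδ : 0 < δ)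
    (hy : IsExactSolution (fun t x => fF t x + fS t x) t₀ δ y) (hr : 0 < r)
    {φ₀ φ₁ φ₂ : EuclideanSpace ℝ (Fin d)} (hφ : ∀ h ∈ Set.Icc 0 δ,
      ‖fS (t₀ + h) (y (t₀ + h)) - φ₀ - h • φ₁ - h ^ 2 • φ₂‖ ≤ Kφ * h ^ 3) :
    ∃ H₀ ∈ Set.Ioc 0 δ, ∃ C, ∀ H ∈ Set.Ioc 0 H₀,
      (∃ Y y₁, (∀ i, Y i ∈ Metric.closedBall (y t₀) r) ∧ M.Step fF fS t₀ (y t₀) H Y y₁) ∧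
      ∀ Y y₁, (∀ i, Y i ∈ Metric.closedBall (y t₀) r) → M.Step fF fS t₀ (y t₀) H Y y₁ →
        ‖y₁ - y (t₀ + H) - (H ^ 3 * (M.base.deltaC ⬝ᵥ (M.frakA *ᵥ M.base.c) - 1 / 6)) •
          fderiv ℝ (fF t₀) (y t₀) φ₁‖ ≤ C * H ^ 4 := by
  obtain ⟨K, N, hbd⟩ := exists_stepBound hM hF hS t₀ hδ (y t₀) (by linarith : 0 ≤ r + 1)
  obtain ⟨a, b, K', hquad⟩ := ContDiffOn.exists_norm_sub_quadratic_le hδ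
    (by exact_mod_cast hy.contDiffOn (hF.add hS) hδ 3)
  obtain ⟨Ky, hKy, hyle⟩ := exists_norm_sub_le_of_quadratic (f := fun h => y (t₀ + h)) hquad
  have hB := hbd.speed_pos
  have hN := hbd.nonneg
  have hK := hbd.fast.nonneg
  -- each summand guards against one of the ways in which a step may leave the cylinder
  set D := 1 + speed K N + 2 * (N * K) + s * speed K N / r + Ky with hD
  have hNK : 0 ≤ N * K := mul_nonneg hN hK
  have hsB : 0 ≤ s * speed K N / r := by positivity
  have hD0 : 0 < D := by positivity
  have hH₀ : min δ (1 / D) ∈ Set.Ioc 0 δ := ⟨lt_min hδ (by positivity), min_le_left _ _⟩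
  have hsmall : ∀ H ∈ Set.Ioc 0 (min δ (1 / D)), H ≤ 1 ∧ H ≤ δ ∧ H * speed K N ≤ 1 ∧
      H * (N * K) ≤ 1 / 2 ∧ s * (H * speed K N) ≤ r ∧ H * Ky ≤ 1 := by
    intro H hH
    have hH0 := hH.1.le
    have h1 : H * D ≤ 1 := (le_div_iff₀ hD0).1 (hH.2.trans (min_le_right _ _))
    have e1 := mul_nonneg hH0 hB.le
    have e2 := mul_nonneg hH0 hNK
    have e3 := mul_nonneg hH0 hsB
    have e4 := mul_nonneg hH0 hKy
    have h2 : H * D = H + H * speed K N + 2 * (H * (N * K)) + H * (s * speed K N / r) + H * Ky := by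
      rw [hD]; ring
    refine ⟨by linarith, hH.2.trans (min_le_left _ _), by linarith, by linarith, ?_, by linarith⟩
    have h3 : H * (s * speed K N / r) ≤ 1 := by linarith
    rw [mul_div_assoc', div_le_one hr] at h3
    linarith
  let ι := {p : ℝ × (Fin (s + 1) → EuclideanSpace ℝ (Fin d)) ×
    (Fin s → ℝ → EuclideanSpace ℝ (Fin d)) // p.1 ∈ Set.Ioc 0 (min δ (1 / D)) ∧
      (∀ i, p.2.1 i ∈ Metric.closedBall (y t₀) r) ∧ p.2.1 0 = y t₀ ∧
      ∀ i, M.IsStage fF fS t₀ p.1 p.2.1 i (p.2.2 i)}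
  let 𝔉 : StepFamily M fF fS ι :=
    { t₀ := t₀, δ := δ, r := r, K := K, N := N, Ky := Ky, Kφ := Kφ, y := y
      AF := fderiv ℝ (fF t₀) (y t₀), AS := fderiv ℝ (fS t₀) (y t₀)
      φ₀ := φ₀, φ₁ := φ₁, φ₂ := φ₂
      H := fun p => p.1.1, Y := fun p => p.1.2.1, v := fun p => p.1.2.2
      node_zero := hn, bound := hbd, isExact := hy, y_le := hyle, φ_le := hφ
      pos := fun p => p.2.1.1
      le_one := fun p => (hsmall _ p.2.1).1
      le_δ := fun p => (hsmall _ p.2.1).2.1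
      speed_le := fun p => (hsmall _ p.2.1).2.2.1
      y_mem := fun p h hh => by
        obtain ⟨-, h1, -, -, -, h2⟩ := hsmall _ p.2.1
        rw [mem_closedBall_iff_norm]
        refine (hyle h ⟨hh.1, hh.2.trans h1⟩).trans ?_
        have : Ky * h ≤ Ky * p.1.1 := mul_le_mul_of_nonneg_left hh.2 hKy
        linarith
      start := fun p => p.2.2.2.1
      mem := fun p => p.2.2.1
      stage := fun p => p.2.2.2.2 }
  obtain ⟨C, -, hC⟩ := isBigO_unitTime_exists (g := fun p => 𝔉.H p ^ 4)
    (f := fun p _ => 𝔉.Y p (Fin.last s) - 𝔉.y (𝔉.t₀ + 𝔉.H p) -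
      (𝔉.H p ^ 3 * (M.base.deltaC ⬝ᵥ (M.frakA *ᵥ M.base.c) - 1 / 6)) • 𝔉.AF 𝔉.φ₁)
    (𝔉.isBigO_error hb hb2 hbA)
  refine ⟨_, hH₀, C, fun H hH => ⟨?_, fun Y y₁ hY hst => ?_⟩⟩
  · obtain ⟨-, h2, h3, h4, h5, -⟩ := hsmall H hH
    exact hbd.exists_step hF hH.1 h2 h3 h4 h5
  · obtain ⟨h0, hv, hy₁⟩ := (step_iff_isStage M fF fS t₀ (y t₀) hH.1 Y y₁).1 hst
    choose v hv using hv
    have h := hC ⟨(H, Y, v), hH, hY, h0, hv⟩ 0 (Set.left_mem_Icc.2 zero_le_one)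
    rw [Real.norm_of_nonneg (pow_nonneg hH.1.le 4)] at h
    rw [hy₁]
    exact h

/-- The order conditions of the slow base scheme that enter the error expansion. -/
theorem base_conditions {M : MRIGARK s m} (hM : M.InternallyConsistent)
    (h : M.base.HasOrder 3) : M.base.node 0 = 0 ∧ ∑ j, M.base.b j * M.base.c j ^ 1 = 1 / 2 ∧
      ∑ j, M.base.b j * M.base.c j ^ 2 = 1 / 3 ∧
      ∑ j, M.base.b j * (M.base.A *ᵥ M.base.c) j = 1 / 6 := by
  refine ⟨?_, ?_, ?_, ?_⟩
  · have h0 := h.sum_b_mul_c_pow (k := 0) (by norm_num)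
    -- a method without stages is not consistent
    have hs : 0 < s := by
      rcases Nat.eq_zero_or_pos s with rfl | hs
      · simp at h0
      · exact hs
    exact hM.node_zero ⟨0, hs⟩
  · rw [h.sum_b_mul_c_pow (by norm_num)]; norm_num
  · rw [h.sum_b_mul_c_pow (by norm_num)]; norm_num
  · have h1 := h.sum_b_mul_A_mul_c_pow (k := 1) (by norm_num)
    simp only [pow_one] at h1
    rw [h1, zeta_eq]
    norm_num

theorem hasOrder_three_of_coupling {M : MRIGARK s m} (hM : M.InternallyConsistent)
    (h : M.base.HasOrder 3) (hκ : M.base.deltaC ⬝ᵥ (M.frakA *ᵥ M.base.c) = 1 / 6) :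
    M.HasOrder 3 := by
  intro d fF fS hF hS t₀ δ y hδ hy
  obtain ⟨hn, hb, hb2, hbA⟩ := base_conditions hM h
  have hφ : ContDiffOn ℝ 3 (fun t => fS t (y t)) (Set.Icc t₀ (t₀ + δ)) := by
    exact_mod_cast hS.contDiffOn_comp (hy.contDiffOn (hF.add hS) hδ 3)
  obtain ⟨a, b, K, hK⟩ := hφ.exists_norm_sub_quadratic_le hδ
  obtain ⟨H₀, hH₀, C, hC⟩ := exists_local_error_expansion hM hn hb hb2 hbA hF hS hδ hy one_pos hK
  refine ⟨H₀, hH₀, 1, one_pos, C, fun H hH => ⟨(hC H hH).1, fun Y y₁ hY hst => ?_⟩⟩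
  simpa [hκ] using (hC H hH).2 Y y₁ hY hst

/-- The coupling condition is necessary: on the scalar problem `y' = y + t` with fast part `y` and
slow part `t`, the leading term of the local error is `H³` times its defect. -/
theorem HasOrder.coupling {M : MRIGARK s m} (hM : M.InternallyConsistent) (h : M.HasOrder 3) :
    M.base.deltaC ⬝ᵥ (M.frakA *ᵥ M.base.c) = 1 / 6 := by
  obtain ⟨hn, hb, hb2, hbA⟩ := base_conditions hM (h.base hM)
  set e : EuclideanSpace ℝ (Fin 1) := EuclideanSpace.single 0 1 with he
  have hF : IsSmoothField fun (_ : ℝ) (x : EuclideanSpace ℝ (Fin 1)) => x := contDiff_snd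
  have hS : IsSmoothField fun (t : ℝ) (_ : EuclideanSpace ℝ (Fin 1)) => t • e :=
    contDiff_fst.smul contDiff_const
  have hy : IsExactSolution (fun t x => x + t • e) 0 1 fun t => (-1 - t) • e := by
    intro t _
    have hd : HasDerivAt (fun t : ℝ => -1 - t) (-1) t := by
      simpa using (hasDerivAt_id t).const_sub (-1)
    refine (hd.smul_const e).hasDerivWithinAt.congr_deriv ?_
    module
  obtain ⟨H₁, hH₁, r, hr, C₁, hC₁⟩ := h 1 _ _ hF hS 0 1 _ one_pos hy
  obtain ⟨H₂, hH₂, C₂, hC₂⟩ := exists_local_error_expansion hM hn hb hb2 hbA hF hS one_pos hy hr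
    (φ₀ := 0) (φ₁ := e) (φ₂ := 0) (Kφ := 0) (fun h _ => by simp)
  refine sub_eq_zero.1 (eq_zero_of_abs_mul_pow_le (q := 3) (C := C₁ + C₂)
    (lt_min hH₁.1 hH₂.1) fun H hH => ?_)
  obtain ⟨⟨Y, y₁, hY, hst⟩, hall⟩ := hC₁ H ⟨hH.1, hH.2.trans (min_le_left _ _)⟩
  have h1 : ‖y₁ - (-1 - (0 + H)) • e‖ ≤ C₁ * H ^ (3 + 1) := hall Y y₁ hY hst
  have h2 := (hC₂ H ⟨hH.1, hH.2.trans (min_le_right _ _)⟩).2 Y y₁ hY hst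
  have hfd : ∀ x : EuclideanSpace ℝ (Fin 1),
      fderiv ℝ (fun x : EuclideanSpace ℝ (Fin 1) => x) x e = e := fun x => by simp
  rw [hfd] at h2
  set κ := M.base.deltaC ⬝ᵥ (M.frakA *ᵥ M.base.c) - 1 / 6 with hκ
  have hnorm : ‖(H ^ 3 * κ) • e‖ = |κ| * H ^ 3 := by
    rw [norm_smul, norm_mul, Real.norm_of_nonneg (pow_nonneg hH.1.le 3), Real.norm_eq_abs, he]
    simp [mul_comm]
  have htri := norm_sub_le (y₁ - (-1 - (0 + H)) • e) (y₁ - (-1 - (0 + H)) • e - (H ^ 3 * κ) • e)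
  rw [sub_sub_cancel, hnorm] at htri
  exact htri.trans ((add_le_add h1 h2).trans_eq (by ring))

end MRIGARK

end

theorem mainTheorem2 (s m : ℕ) (M : MRIGARK s m) (hM : M.InternallyConsistent) :
    (M.HasOrder 3 ↔
      M.base.HasOrder 3 ∧ M.base.deltaC ⬝ᵥ (M.frakA *ᵥ M.base.c) = 1 / 6) ∧
    (∀ (n : ℕ) (F : RKMethod n), F.HasOrder (m + 2) →
      (M.base.HasOrder 3 →
        M.base.b ⬝ᵥ (M.tabAsf F *ᵥ (M.tabAff F *ᵥ 1)) = 1 / 6) ∧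
      M.tabbf F ⬝ᵥ (M.tabAfs F *ᵥ M.base.c) = M.base.deltaC ⬝ᵥ (M.frakA *ᵥ M.base.c) ∧
      (M.tabbf F ⬝ᵥ (M.tabAfs F *ᵥ M.base.c) = 1 / 6 ↔
        M.base.deltaC ⬝ᵥ (M.frakA *ᵥ M.base.c) = 1 / 6)) := by
  refine ⟨⟨fun h => ⟨h.base hM, h.coupling hM⟩,
    fun h => MRIGARK.hasOrder_three_of_coupling hM h.1 h.2⟩, fun n F hF => ?_⟩
  have hb : ∑ a, F.b a = 1 := by simpa using hF.sum_b_mul_c_pow (k := 0) (by omega)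
  have hbc : ∑ a, F.b a * F.c a = 1 / 2 := by
    have h := hF.sum_b_mul_c_pow (k := 1) (by omega)
    norm_num at h ⊢
    exact h
  have hfs := M.tabbf_dotProduct_tabAfs F hb fun k => hF.sum_b_mul_A_mul_c_pow (by omega)
  refine ⟨fun h => ?_, hfs, by rw [hfs]⟩
  rw [hM.b_dotProduct_tabAsf F hb hbc, (MRIGARK.base_conditions hM h).2.2.1]
  norm_num
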